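/- Let $k\ge 1$, $\alpha\in(0,1)$, and let $e_1$ be the first standard basis vector of $\mathbb{R}^k$. For every sample size $n\ge 1$ let $\mathcal{F}_n$ be a non-empty parameter space; each $F\in\mathcal{F}_n$ has a true parameter $\theta_F\in\mathbb{R}^k$ and determines the distribution $P_F$ of an estimator $\widehat\theta$ with values in $\mathbb{R}^k$ and of a symmetric random $k\times k$ matrix $\widehat V$ (both depend on $n$). Let $g(\theta)=a'\theta+b$ with $a\in\mathbb{R}^k$, $b\in\mathbb{R}$ and $e_1e_1'a\ne a$ (that is, $a$ is not a scalar multiple of $e_1$). Let $z_{1-\alpha/2}$ be the $1-\alpha/2$ quantile of the standard normal distribution and put \[ \hat s=n^{-1/2}(e_1'\widehat Ve_1)^{1/2},\qquad \ddot\theta=\widehat\theta-\widehat Va(a'\widehat Va)^{-1}g(\widehat\theta),\qquad \ddot s=n^{-1/2}\bigl(e_1'\widehat Ve_1-e_1'\widehat Va(a'\widehat Va)^{-1}a'\widehat Ve_1\bigr)^{1/2}, \] let $\ddot c=(e_1'\widehat Va)^{-1}(a'\widehat Va)(\hat s-\ddot s)z_{1-\alpha/2}$ if $e_1'\widehat Va\neq0$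 and $\ddot c=0$ otherwise, and let $IICI=[\ell,u]$, where \[ \ell=\begin{cases}e_1'\widehat\theta-\hat s z_{1-\alpha/2}&\text{if }g(\widehat\theta)\le\ddot c\\ e_1'\ddot\theta-\ddot s z_{1-\alpha/2}&\text{if }g(\widehat\theta)>\ddot c\end{cases}\qquad u=\begin{cases}e_1'\widehat\theta+\hat s z_{1-\alpha/2}&\text{if }g(\widehat\theta)\le-\ddot c\\ e_1'\ddot\theta+\ddot s z_{1-\alpha/2}&\text{if }g(\widehat\theta)>-\ddot c.\end{cases} \] Assume that for every sequence $\{F_n\}_{n=1}^\infty$ with $F_n\in\mathcal{F}_n$ and every subsequence $n_m$ there exist a further subsequence $n_q$ and a symmetric positive definite matrix $V$ such that, under $F_{n_q}$, $\sqrt{n_q}(\widehat\theta-\theta_{F_{n_q}})\to_d N(0,V)$ and $\widehat V\to_p V$ as $q\to\infty$. Then \[ \liminf_{n\to\infty}\ \inf_{\{F\in\mathcal{F}_n:\,g(\theta_F)\le0\}}P_F(e_1'\theta_F\in IICI)\ \ge\ 1-\alpha \] (with $\inf\emptyset=+\infty$). Furthermore, if $F_n\in\mathcal{F}_n$ is a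 sequence such that $\sqrt n\,g(\theta_{F_n})\to0$, then $P_{F_n}(e_1'\theta_{F_n}\in IICI)\to1-\alpha$ as $n\to\infty$. -/

import Mathlib

open MeasureTheory ProbabilityTheory Filter Topology
open scoped Matrix

noncomputable section

namespace IICI

/-- The `p`-quantile of the standard normal distribution (`0 < p < 1`):
the smallest `x` with `p ≤ Φ(x)`. -/
def normalQuantile (p : ℝ) : ℝ :=
  sInf {x : ℝ | p ≤ cdf (gaussianReal 0 1) x}

variable {k : ℕ}

/-- The linear function `g(θ) = a'θ + b`. -/
def g (a : EuclideanSpace ℝ (Fin k)) (b : ℝ) (θ : EuclideanSpace ℝ (Fin k)) : ℝ :=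
  a.ofLp ⬝ᵥ θ.ofLp + b

/-- The bilinear form `x'Vy`. -/
def form (V : Matrix (Fin k) (Fin k) ℝ) (x y : EuclideanSpace ℝ (Fin k)) : ℝ :=
  x.ofLp ⬝ᵥ (V *ᵥ y.ofLp)

/-- The first standard basis vector of `ℝᵏ`. -/
def e₁ [NeZero k] : EuclideanSpace ℝ (Fin k) := EuclideanSpace.single 0 1

variable [NeZero k]

/-- The standard error `ŝ = n^{-1/2} (e₁'V e₁)^{1/2}` of the unrestricted estimator. -/
def sHat (n : ℕ+) (V : Matrix (Fin k) (Fin k) ℝ) : ℝ :=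
  (√(n : ℝ))⁻¹ * √(form V e₁ e₁)

/-- The equality-imposed estimator `θ̂ - V a (a'V a)⁻¹ g(θ̂)`. -/
def eqEstimator (a : EuclideanSpace ℝ (Fin k)) (b : ℝ)
    (t : EuclideanSpace ℝ (Fin k)) (V : Matrix (Fin k) (Fin k) ℝ) :
    EuclideanSpace ℝ (Fin k) :=
  t - ((form V a a)⁻¹ * g a b t) • WithLp.toLp 2 (V *ᵥ a.ofLp)

/-- The standard error
`n^{-1/2} (e₁'V e₁ - e₁'V a (a'V a)⁻¹ a'V e₁)^{1/2}` of the equality-imposed estimator. -/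
def sEq (n : ℕ+) (a : EuclideanSpace ℝ (Fin k)) (V : Matrix (Fin k) (Fin k) ℝ) : ℝ :=
  (√(n : ℝ))⁻¹ * √(form V e₁ e₁ - form V e₁ a * (form V a a)⁻¹ * form V a e₁)

open Classical in
/-- The threshold between the usual and the equality-imposed endpoints. -/
def threshold (n : ℕ+) (α : ℝ) (a : EuclideanSpace ℝ (Fin k))
    (V : Matrix (Fin k) (Fin k) ℝ) : ℝ :=
  if form V e₁ a ≠ 0 then
    (form V e₁ a)⁻¹ * form V a a * (sHat n V - sEq n a V) * normalQuantile (1 - α / 2)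
  else 0

open Classical in
/-- The lower endpoint of the inequality-imposed confidence interval. -/
def lower (n : ℕ+) (α : ℝ) (a : EuclideanSpace ℝ (Fin k)) (b : ℝ)
    (t : EuclideanSpace ℝ (Fin k)) (V : Matrix (Fin k) (Fin k) ℝ) : ℝ :=
  if g a b t ≤ threshold n α a V then
    t 0 - sHat n V * normalQuantile (1 - α / 2)
  else
    eqEstimator a b t V 0 - sEq n a V * normalQuantile (1 - α / 2)

open Classical in
/-- The upper endpoint of the inequality-imposed confidence interval. -/
def upper (n : ℕ+) (α : ℝ) (a : EuclideanSpace ℝ (Fin k)) (b : ℝ)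
    (t : EuclideanSpace ℝ (Fin k)) (V : Matrix (Fin k) (Fin k) ℝ) : ℝ :=
  if g a b t ≤ -threshold n α a V then
    t 0 + sHat n V * normalQuantile (1 - α / 2)
  else
    eqEstimator a b t V 0 + sEq n a V * normalQuantile (1 - α / 2)

/-- The inequality-imposed confidence interval (IICI) of nominal level `1 - α` for the first
coordinate, at sample size `n`, computed from the value `t` of the estimator `θ̂` and the value
`V` of the variance estimator `V̂`. -/
def interval (n : ℕ+) (α : ℝ) (a : EuclideanSpace ℝ (Fin k)) (b : ℝ)
    (t : EuclideanSpace ℝ (Fin k)) (V : Matrix (Fin k) (Fin k) ℝ) : Set ℝ :=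
  Set.Icc (lower n α a b t V) (upper n α a b t V)

/-- Convergence in probability of random matrices, defined on possibly different probability
spaces, to a constant matrix (entry by entry). -/
def TendstoInProb {m : ℕ} {Ω : ℕ → Type*} [∀ q, MeasurableSpace (Ω q)]
    (μ : ∀ q, Measure (Ω q)) (X : ∀ q, Ω q → Matrix (Fin m) (Fin m) ℝ)
    (V : Matrix (Fin m) (Fin m) ℝ) : Prop :=
  ∀ i j, ∀ ε : ℝ, 0 < ε →
    Tendsto (fun q => μ q {ω | ε ≤ |X q ω i j - V i j|}) atTop (𝓝 0)

/-- The asymptotic model: for every sequence `Fₙ ∈ 𝓕ₙ` and every subsequence `n_m`, there are a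
further subsequence `n_q` and a symmetric positive definite matrix `V` such that, under `F_{n_q}`,
`√n_q (θ̂ - θ_{F_{n_q}})` converges in distribution to `N(0, V)` and `V̂` converges in probability
to `V`. -/
def AsymptoticNormality {m : ℕ} {𝓕 : ℕ+ → Type*} {Ω : ℕ+ → Type*}
    [∀ n, MeasurableSpace (Ω n)]
    (P : ∀ n, 𝓕 n → Measure (Ω n)) [∀ n F, IsProbabilityMeasure (P n F)]
    (θ : ∀ n, 𝓕 n → EuclideanSpace ℝ (Fin m))
    (θhat : ∀ n, Ω n → EuclideanSpace ℝ (Fin m))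
    (Vhat : ∀ n, Ω n → Matrix (Fin m) (Fin m) ℝ) : Prop :=
  ∀ F : (∀ n, 𝓕 n), ∀ φ : ℕ → ℕ+, StrictMono φ →
    ∃ ψ : ℕ → ℕ, StrictMono ψ ∧ ∃ V : Matrix (Fin m) (Fin m) ℝ, V.PosDef ∧
      TendstoInDistribution
        (fun q (ω : Ω (φ (ψ q))) =>
          √((φ (ψ q) : ℕ+) : ℝ) • (θhat (φ (ψ q)) ω - θ (φ (ψ q)) (F (φ (ψ q)))))
        atTop (id : EuclideanSpace ℝ (Fin m) → EuclideanSpace ℝ (Fin m))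
        (fun q => P (φ (ψ q)) (F (φ (ψ q)))) (multivariateGaussian 0 V) ∧
      TendstoInProb (fun q => P (φ (ψ q)) (F (φ (ψ q)))) (fun q => Vhat (φ (ψ q))) V

end IICI

end

/-! Centre the endpoints at the true first coordinate, multiply by `√n`, and write `v = e₁'Va`, `w =
a'Va`. The threshold is exactly the point where the usual and the equality-imposed endpoints cross,
so each endpoint is the minimum of the two candidates when `v > 0` and their maximum when `v < 0`.
Near `v = 0` the candidates have the same limit, hence the branch does not matter. The endpoints are
therefore asymptotically continuous functions of the normal limit, and coverage converges along
subsequences on which `√n g(θ)` tends to some `h ≤ 0` or to `-∞`.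

At `-∞` the usual interval is selected, with limiting coverage `1 - α`. At a finite `h`, the two
standardized estimators form a Gaussian pair `(X, Y)` with standard margins and nonnegative
correlation. After a change of sign if `v < 0`, coverage means `min (X - z) (Y + d - z) ≤ 0 ≤ min (X
+ z) (Y + d + z)`, with `d ≥ 0` proportional to `-h`.

The core is `IsStandardPair.le_measureReal_coverage`. Exchange and sign symmetry reduce the
non-coverage probability to `α` plus the mass of one region minus the mass of its mirror image
across `x + y = 2z`. Since `X + Y` is centred normal and independent of `Y - X`, the image, which
lies nearer the origin, has at least as much mass. At `d = 0` both regions are empty, which gives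
exact coverage. Subsequence extraction then yields both claims. -/

/-! ### Exchangeable pairs of standard normal variables -/

/-- The properties of the law of a nondegenerate exchangeable pair of standard normal variables
that the coverage bound uses: standard normal marginals, invariance under exchange and under
change of sign, and a reflection inequality across the antidiagonal `x + y = 2c`. -/
structure IsStandardPair (m : Measure (ℝ × ℝ)) : Prop where
  map_fst : m.map Prod.fst = gaussianReal 0 1
  map_swap : m.map Prod.swap = m
  map_neg : m.map (fun p => -p) = m
  reflect_le : ∀ c : ℝ, 0 ≤ c → ∀ S : Set (ℝ × ℝ), MeasurableSet S →
    (∀ p ∈ S, 2 * c ≤ p.1 + p.2) → m S ≤ m {p | (2 * c - p.2, 2 * c - p.1) ∈ S}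

/-- For `x ≥ c ≥ 0` the reflected point `2c - x` is no farther from `0` than `x`, so the centred
density is at least as large there. The reflected mass is computed as a mass under the normal law
with mean `2c`. -/
lemma gaussianReal_le_gaussianReal_reflect {v : NNReal} (hv : v ≠ 0) {c : ℝ} (hc : 0 ≤ c)
    {A : Set ℝ} (hA : MeasurableSet A) (hAc : ∀ x ∈ A, c ≤ x) :
    gaussianReal 0 v A ≤ gaussianReal 0 v {x | 2 * c - x ∈ A} := by
  have h : gaussianReal 0 v {x | 2 * c - x ∈ A} = gaussianReal (2 * c) v A := by
    have := gaussianReal_map_const_sub (μ := 0) (v := v) (2 * c)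
    rw [sub_zero] at this
    rw [← this, Measure.map_apply (by fun_prop) hA]
    rfl
  rw [h, gaussianReal_apply _ hv, gaussianReal_apply _ hv]
  refine setLIntegral_mono' hA fun x hx => ENNReal.ofReal_le_ofReal ?_
  have := hAc x hx
  unfold gaussianPDFReal
  gcongr 1
  refine Real.exp_le_exp.2 (div_le_div_of_nonneg_right ?_ (by positivity))
  nlinarith

lemma prod_gaussianReal_le_reflect {v : NNReal} (hv : v ≠ 0) (w : NNReal) {c : ℝ} (hc : 0 ≤ c)
    {S : Set (ℝ × ℝ)} (hS : MeasurableSet S) (hSc : ∀ p ∈ S, c ≤ p.1) :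
    (gaussianReal 0 v).prod (gaussianReal 0 w) S ≤
      (gaussianReal 0 v).prod (gaussianReal 0 w) {p | (2 * c - p.1, p.2) ∈ S} := by
  have hS' : MeasurableSet {p : ℝ × ℝ | (2 * c - p.1, p.2) ∈ S} :=
    hS.preimage (f := fun p : ℝ × ℝ => (2 * c - p.1, p.2)) (by fun_prop)
  rw [Measure.prod_apply_symm hS, Measure.prod_apply_symm hS']
  refine lintegral_mono fun y => ?_
  exact gaussianReal_le_gaussianReal_reflect hv hc (A := (fun x => (x, y)) ⁻¹' S)
    (hS.preimage (by fun_prop)) fun x hx => hSc _ hx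

/-- Equal variances make `X + Y` and `Y - X` uncorrelated, hence independent. Exchange flips the
sign of the difference only, and reflection across the antidiagonal acts on the sum only, so every
property is read off a product of centred normals. -/
lemma isStandardPair_of_hasGaussianLaw {Ω : Type*} [MeasurableSpace Ω] {P : Measure Ω}
    {X Y : Ω → ℝ} (hX : Measurable X) (hY : Measurable Y)
    (h : HasGaussianLaw (fun ω => (X ω, Y ω)) P)
    (hX0 : P[X] = 0) (hY0 : P[Y] = 0) (hX1 : Var[X; P] = 1) (hY1 : Var[Y; P] = 1)
    (hcov : -1 < cov[X, Y; P]) :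
    IsStandardPair (P.map fun ω => (X ω, Y ω)) := by
  have := h.isProbabilityMeasure
  have hmX : MemLp X 2 P := h.fst.memLp_two
  have hmY : MemLp Y 2 P := h.snd.memLp_two
  have hAB : HasGaussianLaw (fun ω => (X ω + Y ω, Y ω - X ω)) P :=
    h.map_fun ((ContinuousLinearMap.fst ℝ ℝ ℝ + ContinuousLinearMap.snd ℝ ℝ ℝ).prod
      (ContinuousLinearMap.snd ℝ ℝ ℝ - ContinuousLinearMap.fst ℝ ℝ ℝ))
  have hind : IndepFun (X + Y) (Y - X) P := by
    refine HasGaussianLaw.indepFun_of_covariance_eq_zero hAB ?_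
    rw [covariance_add_left hmX hmY (hmY.sub hmX), covariance_sub_right hmX hmY hmX,
      covariance_sub_right hmY hmY hmX, covariance_self hX.aemeasurable,
      covariance_self hY.aemeasurable, covariance_comm Y X, hX1, hY1]
    ring
  have hA0 : P[X + Y] = 0 := by
    simp [integral_add (hmX.integrable (by norm_num)) (hmY.integrable (by norm_num)), hX0, hY0]
  have hB0 : P[Y - X] = 0 := by
    simp [integral_sub (hmY.integrable (by norm_num)) (hmX.integrable (by norm_num)), hX0, hY0]
  set v : NNReal := Var[X + Y; P].toNNReal with hv
  set w : NNReal := Var[Y - X; P].toNNReal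
  -- Only the sum must be nondegenerate. The difference may have variance `0`, which allows the pair
  -- `(X, X)`.
  have hv0 : v ≠ 0 := by
    rw [hv, variance_add hmX hmY, hX1, hY1]
    simp only [ne_eq, Real.toNNReal_eq_zero, not_le]
    linarith
  set m₀ := (gaussianReal 0 v).prod (gaussianReal 0 w) with hm₀
  have hlaw : P.map (fun ω => ((X + Y) ω, (Y - X) ω)) = m₀ := by
    rw [(indepFun_iff_map_prod_eq_prod_map_map (by fun_prop) (by fun_prop)).1 hind,
      HasGaussianLaw.map_eq_gaussianReal (X := X + Y) hAB.fst,
      HasGaussianLaw.map_eq_gaussianReal (X := Y - X) hAB.snd, hA0, hB0]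
  let τ : ℝ × ℝ → ℝ × ℝ := fun p => ((p.1 - p.2) / 2, (p.1 + p.2) / 2)
  have hτ : Measurable τ := by fun_prop
  have hm : (P.map fun ω => (X ω, Y ω)) = m₀.map τ := by
    rw [← hlaw, Measure.map_map hτ (by fun_prop)]
    congr 1
    ext ω <;> simp [τ] <;> ring
  have hneg (u : NNReal) : (gaussianReal 0 u).map (fun x => -x) = gaussianReal 0 u := by
    simp [gaussianReal_map_neg]
  have hmarg : (P.map fun ω => (X ω, Y ω)).map Prod.fst = gaussianReal 0 1 := by
    rw [Measure.map_map (by fun_prop) (by fun_prop)]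
    have := h.fst.map_eq_gaussianReal
    rw [hX0, hX1] at this
    simpa [Function.comp_def] using this
  refine ⟨hmarg, ?_, ?_, ?_⟩
  · have h1 : m₀.map (fun p => (p.1, -p.2)) = m₀ := by
      have := Measure.map_prod_map (gaussianReal 0 v) (gaussianReal 0 w) (measurable_id)
        (measurable_neg (G := ℝ))
      rw [Measure.map_id, hneg] at this
      exact this.symm
    rw [hm, Measure.map_map (by fun_prop) hτ]
    nth_rw 2 [← h1]
    rw [Measure.map_map hτ (by fun_prop)]
    congr 1
    ext p <;> simp [τ]
    ring
  · have h1 : m₀.map (fun p => (-p.1, -p.2)) = m₀ := by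
      have := Measure.map_prod_map (gaussianReal 0 v) (gaussianReal 0 w) (measurable_neg (G := ℝ))
        (measurable_neg (G := ℝ))
      rw [hneg, hneg] at this
      exact this.symm
    rw [hm, Measure.map_map (by fun_prop) hτ]
    nth_rw 2 [← h1]
    rw [Measure.map_map hτ (by fun_prop)]
    congr 1
    ext p <;> simp [τ] <;> ring
  · intro c hc S hS hSc
    have hS' : MeasurableSet {p : ℝ × ℝ | (2 * c - p.2, 2 * c - p.1) ∈ S} :=
      hS.preimage (f := fun p : ℝ × ℝ => (2 * c - p.2, 2 * c - p.1)) (by fun_prop)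
    rw [hm, Measure.map_apply hτ hS, Measure.map_apply hτ hS']
    refine (prod_gaussianReal_le_reflect hv0 w (c := 2 * c) (by linarith) (hS.preimage hτ)
      fun p hp => ?_).trans (le_of_eq ?_)
    · have := hSc _ hp
      simp only [τ] at this
      linarith
    · congr 1
      ext p
      simp only [τ, Set.mem_preimage, Set.mem_ofPred_eq]
      have e : ((2 * (2 * c) - p.1 - p.2) / 2, (2 * (2 * c) - p.1 + p.2) / 2) =
        (2 * c - (p.1 + p.2) / 2, 2 * c - (p.1 - p.2) / 2) := by
        ext <;> simp <;> ring
      rw [e]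

/-! ### Coverage probability of a standard pair. -/

namespace IsStandardPair

variable {m : Measure (ℝ × ℝ)} {z d α : ℝ}

lemma isProbabilityMeasure (h : IsStandardPair m) : IsProbabilityMeasure m := by
  have : IsProbabilityMeasure (m.map Prod.fst) := by rw [h.map_fst]; infer_instance
  exact Measure.isProbabilityMeasure_of_map Prod.fst

lemma measure_fst_eq (h : IsStandardPair m) (c : ℝ) : m {p | p.1 = c} = 0 := by
  have h1 : m.map Prod.fst {c} = 0 := by
    have := nullSingletonClass_gaussianReal (μ := 0) (one_ne_zero (α := NNReal))
    rw [h.map_fst]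
    exact measure_singleton c
  rwa [Measure.map_apply measurable_fst (measurableSet_singleton c)] at h1

lemma measureReal_swap (h : IsStandardPair m) {S : Set (ℝ × ℝ)} (hS : MeasurableSet S) :
    m.real {p | (p.2, p.1) ∈ S} = m.real S := by
  rw [measureReal_def, measureReal_def]
  congr 1
  conv_rhs => rw [← h.map_swap, Measure.map_apply measurable_swap hS]
  rfl

lemma measureReal_neg (h : IsStandardPair m) {S : Set (ℝ × ℝ)} (hS : MeasurableSet S) :
    m.real {p | (-p.1, -p.2) ∈ S} = m.real S := by
  rw [measureReal_def, measureReal_def]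
  congr 1
  conv_rhs => rw [← h.map_neg, Measure.map_apply (by fun_prop) hS]
  rfl

lemma measure_snd_eq (h : IsStandardPair m) (c : ℝ) : m {p | p.2 = c} = 0 := by
  have := h.isProbabilityMeasure
  have h1 := h.measureReal_swap (S := {p | p.1 = c}) (measurableSet_eq_fun (by fun_prop) (by fun_prop))
  rw [measureReal_def m {p | p.1 = c}, h.measure_fst_eq] at h1
  exact (measureReal_eq_zero_iff (measure_ne_top _ _)).1 h1

lemma measureReal_fst_gt (h : IsStandardPair m) (hz : cdf (gaussianReal 0 1) z = 1 - α / 2) :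
    m.real {p | z < p.1} = α / 2 := by
  have e : {p : ℝ × ℝ | z < p.1} = Prod.fst ⁻¹' (Set.Iic z)ᶜ := by ext; simp
  rw [e, measureReal_def, ← Measure.map_apply measurable_fst measurableSet_Iic.compl, h.map_fst,
    ← measureReal_def, probReal_compl_eq_one_sub measurableSet_Iic, ← cdf_eq_real, hz]
  ring

/-- The coverage event of the interval with endpoints `min (X - z) (Y + d - z)` and
`min (X + z) (Y + d + z)`. -/
def coverage (z d : ℝ) : Set (ℝ × ℝ) :=
  {p | (p.1 ≤ z ∨ p.2 ≤ z - d) ∧ -z ≤ p.1 ∧ -z - d ≤ p.2}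

lemma measurableSet_coverage : MeasurableSet (coverage z d) := by
  unfold coverage
  measurability

/-- Missing on the left and missing on the right are disjoint because `z ≥ 0`. A change of sign
moves one of them to the upper tails, where it splits into two pieces. -/
lemma measureReal_coverage_compl (h : IsStandardPair m)
    (hz0 : 0 ≤ z) :
    m.real (coverage z d)ᶜ = m.real {p | z < p.1 ∧ z - d < p.2} + m.real {p | z < p.1}
      + m.real {p | p.1 ≤ z ∧ z + d < p.2} := by
  have := h.isProbabilityMeasure
  have e1 : (coverage z d)ᶜ = {p : ℝ × ℝ | z < p.1 ∧ z - d < p.2} ∪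
      {p | p.1 < -z ∨ p.2 < -z - d} := by
    ext p
    simp only [coverage, Set.mem_compl_iff, Set.mem_ofPred_eq, Set.mem_union]
    grind
  have e2 : {p : ℝ × ℝ | p.1 < -z ∨ p.2 < -z - d} =
      {p | (-p.1, -p.2) ∈ {p : ℝ × ℝ | z < p.1 ∨ z + d < p.2}} := by
    ext p
    simp only [Set.mem_ofPred_eq]
    grind
  have e3 : {p : ℝ × ℝ | z < p.1 ∨ z + d < p.2} =
      {p | z < p.1} ∪ {p | p.1 ≤ z ∧ z + d < p.2} := by
    ext p
    simp only [Set.mem_ofPred_eq, Set.mem_union]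
    grind
  rw [e1, measureReal_union ?_ (by measurability), e2, h.measureReal_neg (by measurability), e3,
    measureReal_union ?_ (by measurability)]
  · ring
  · rw [Set.disjoint_left]
    intro p hp
    simp only [Set.mem_ofPred_eq] at hp ⊢
    grind
  · rw [Set.disjoint_left]
    intro p hp
    simp only [Set.mem_ofPred_eq] at hp ⊢
    grind

/-- The reflection `(x, y) ↦ (2z - y, 2z - x)` carries the first region into the second, up to the
null line `y = z`. -/
lemma measureReal_reflect_le (h : IsStandardPair m) (hz0 : 0 ≤ z) :
    m.real {p | (z - d < p.1 ∧ p.1 ≤ z) ∧ z + d < p.2} ≤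
      m.real {p | p.1 ≤ z - d ∧ z < p.2 ∧ p.2 ≤ z + d} := by
  have := h.isProbabilityMeasure
  have h1 := h.reflect_le z hz0 {p | (z - d < p.1 ∧ p.1 ≤ z) ∧ z + d < p.2} (by measurability)
    (fun p hp => by simp only [Set.mem_ofPred_eq] at hp; linarith)
  refine ENNReal.toReal_mono (measure_ne_top _ _) (h1.trans ?_)
  calc _ ≤ m ({p | p.1 ≤ z - d ∧ z < p.2 ∧ p.2 ≤ z + d} ∪ {p | p.2 = z}) := by
        refine measure_mono fun p hp => ?_
        simp only [Set.mem_ofPred_eq, Set.mem_union] at hp ⊢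
        grind
    _ ≤ m {p | p.1 ≤ z - d ∧ z < p.2 ∧ p.2 ≤ z + d} + m {p | p.2 = z} := measure_union_le _ _
    _ = _ := by rw [h.measure_snd_eq, add_zero]

lemma measureReal_snd_gt (h : IsStandardPair m) (z : ℝ) :
    m.real {p | z < p.2} = m.real {p | z < p.1} :=
  h.measureReal_swap (S := {p | z < p.1}) (by measurability)

/-- After an exchange of coordinates, the event lies in `y > z` and can be compared piece by piece
with `measureReal_snd_gt_split`. -/
lemma measureReal_gt_and_gt (h : IsStandardPair m) (hd : 0 ≤ d) :
    m.real {p | z < p.1 ∧ z - d < p.2} = m.real {p | z < p.1 ∧ z < p.2} +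
      (m.real {p | (z - d < p.1 ∧ p.1 ≤ z) ∧ z < p.2 ∧ p.2 ≤ z + d} +
        m.real {p | (z - d < p.1 ∧ p.1 ≤ z) ∧ z + d < p.2}) := by
  have := h.isProbabilityMeasure
  rw [← h.measureReal_swap (S := {p | z < p.1 ∧ z - d < p.2}) (by measurability),
    ← measureReal_union ?_ (by measurability), ← measureReal_union ?_ (by measurability)]
  · congr 1
    ext p
    simp only [Set.mem_ofPred_eq, Set.mem_union]
    grind
  · rw [Set.disjoint_left]
    intro p hp
    simp only [Set.mem_ofPred_eq, Set.mem_union] at hp ⊢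
    grind
  · rw [Set.disjoint_left]
    intro p hp
    simp only [Set.mem_ofPred_eq, Set.mem_union] at hp ⊢
    grind

lemma measureReal_snd_gt_split (h : IsStandardPair m) (hd : 0 ≤ d) :
    m.real {p | z < p.2} = m.real {p | z < p.1 ∧ z < p.2} +
      (m.real {p | p.1 ≤ z ∧ z + d < p.2} +
      (m.real {p | (z - d < p.1 ∧ p.1 ≤ z) ∧ z < p.2 ∧ p.2 ≤ z + d} +
        m.real {p | p.1 ≤ z - d ∧ z < p.2 ∧ p.2 ≤ z + d})) := by
  have := h.isProbabilityMeasure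
  rw [← measureReal_union ?_ (by measurability), ← measureReal_union ?_ (by measurability),
    ← measureReal_union ?_ (by measurability)]
  · congr 1
    ext p
    simp only [Set.mem_ofPred_eq, Set.mem_union]
    grind
  all_goals
    rw [Set.disjoint_left]
    intro p hp
    simp only [Set.mem_ofPred_eq, Set.mem_union] at hp ⊢
    grind

/-- Subtracting the two decompositions cancels every common piece; what remains is the comparison in
`measureReal_reflect_le`. -/
theorem le_measureReal_coverage (h : IsStandardPair m) (hz0 : 0 ≤ z)
    (hz : cdf (gaussianReal 0 1) z = 1 - α / 2) (hd : 0 ≤ d) :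
    1 - α ≤ m.real (coverage z d) := by
  have := h.isProbabilityMeasure
  have h0 := probReal_compl_eq_one_sub (μ := m) (measurableSet_coverage (z := z) (d := d))
  rw [h.measureReal_coverage_compl hz0, h.measureReal_gt_and_gt hd] at h0
  have h1 := h.measureReal_reflect_le (d := d) hz0
  have h2 := h.measureReal_snd_gt_split (z := z) hd
  rw [h.measureReal_snd_gt, h.measureReal_fst_gt hz] at h2
  rw [h.measureReal_fst_gt hz] at h0
  linarith

theorem measureReal_coverage_zero (h : IsStandardPair m) (hz0 : 0 ≤ z)
    (hz : cdf (gaussianReal 0 1) z = 1 - α / 2) :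
    m.real (coverage z 0) = 1 - α := by
  have := h.isProbabilityMeasure
  have h0 := probReal_compl_eq_one_sub (μ := m) (measurableSet_coverage (z := z) (d := 0))
  rw [h.measureReal_coverage_compl hz0, h.measureReal_gt_and_gt le_rfl] at h0
  have h2 := h.measureReal_snd_gt_split (z := z) le_rfl
  rw [h.measureReal_snd_gt, h.measureReal_fst_gt hz] at h2
  rw [h.measureReal_fst_gt hz] at h0
  have e1 : {p : ℝ × ℝ | (z - 0 < p.1 ∧ p.1 ≤ z) ∧ z + 0 < p.2} = ∅ := by
    ext p; simp only [Set.mem_ofPred_eq, Set.mem_empty_iff_false]; grind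
  have e2 : {p : ℝ × ℝ | p.1 ≤ z - 0 ∧ z < p.2 ∧ p.2 ≤ z + 0} = ∅ := by
    ext p; simp only [Set.mem_ofPred_eq, Set.mem_empty_iff_false]; grind
  rw [e1, measureReal_empty] at h0
  rw [e2, measureReal_empty] at h2
  linarith

end IsStandardPair

/-! ### Convergence of coverage probabilities -/

lemma TendstoInDistribution.limsup_measure_closed_le {E : Type*} [TopologicalSpace E]
    [MeasurableSpace E] [OpensMeasurableSpace E] [HasOuterApproxClosed E] {Ω : ℕ → Type*}
    [∀ q, MeasurableSpace (Ω q)]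
    {μ : ∀ q, Measure (Ω q)} [∀ q, IsProbabilityMeasure (μ q)] {ν : Measure E}
    [IsProbabilityMeasure ν] {X : ∀ q, Ω q → E}
    (h : TendstoInDistribution X atTop id μ ν) {C : Set E} (hC : IsClosed C) :
    limsup (fun q => μ q {ω | X q ω ∈ C}) atTop ≤ ν C := by
  have h1 := ProbabilityMeasure.limsup_measure_closed_le_of_tendsto h.tendsto hC
  simp only [ProbabilityMeasure.coe_mk, Measure.map_id] at h1
  refine le_trans (le_of_eq ?_) h1
  congr 1
  ext q
  rw [Measure.map_apply_of_aemeasurable (h.forall_aemeasurable q) hC.measurableSet]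
  rfl

lemma TendstoInDistribution.le_liminf_measure_open {E : Type*} [TopologicalSpace E]
    [MeasurableSpace E] [OpensMeasurableSpace E] [HasOuterApproxClosed E] {Ω : ℕ → Type*}
    [∀ q, MeasurableSpace (Ω q)]
    {μ : ∀ q, Measure (Ω q)} [∀ q, IsProbabilityMeasure (μ q)] {ν : Measure E}
    [IsProbabilityMeasure ν] {X : ∀ q, Ω q → E}
    (h : TendstoInDistribution X atTop id μ ν) {C : Set E} (hC : IsOpen C) :
    ν C ≤ liminf (fun q => μ q {ω | X q ω ∈ C}) atTop := by
  have h1 := ProbabilityMeasure.le_liminf_measure_open_of_tendsto h.tendsto hC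
  simp only [ProbabilityMeasure.coe_mk, Measure.map_id] at h1
  refine le_trans h1 (le_of_eq ?_)
  congr 1
  ext q
  rw [Measure.map_apply_of_aemeasurable (h.forall_aemeasurable q) hC.measurableSet]
  rfl

/-- If the endpoints `ℓ q`, `u q` are approximated in probability by continuous functions of a
sequence converging in distribution, then the probability that they enclose `0` converges to the
probability that the limiting endpoints enclose `0`. -/
theorem tendsto_measure_nonpos_nonneg {E : Type*} [TopologicalSpace E]
    [MeasurableSpace E] [OpensMeasurableSpace E] [HasOuterApproxClosed E] {Ω : ℕ → Type*}
    [∀ q, MeasurableSpace (Ω q)]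
    {μ : ∀ q, Measure (Ω q)} [∀ q, IsProbabilityMeasure (μ q)] {ν : Measure E}
    [IsProbabilityMeasure ν] {X : ∀ q, Ω q → E}
    (h : TendstoInDistribution X atTop id μ ν) {L U : E → ℝ} (hL : Continuous L)
    (hU : Continuous U) (hL0 : ν {x | L x = 0} = 0) (hU0 : ν {x | U x = 0} = 0)
    {ℓ u : ∀ q, Ω q → ℝ}
    (hbad : ∀ ε : ℝ, 0 < ε → Tendsto (fun q => μ q
      {ω | ¬ (|ℓ q ω - L (X q ω)| ≤ ε ∧ |u q ω - U (X q ω)| ≤ ε)}) atTop (𝓝 0)) :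
    Tendsto (fun q => μ q {ω | ℓ q ω ≤ 0 ∧ 0 ≤ u q ω}) atTop
      (𝓝 (ν {x | L x ≤ 0 ∧ 0 ≤ U x})) := by
  obtain ⟨e, he_anti, he_pos, he_lim⟩ := exists_seq_strictAnti_tendsto (0 : ℝ)
  -- Slack `e n` absorbs the approximation error. The open and closed portmanteau bounds then hold
  -- for each `n`, and they meet as `e n → 0` because the limiting endpoints vanish with probability
  -- zero.
  have lower_bd (n : ℕ) : ν {x | L x < -e n ∧ e n < U x} ≤
      liminf (fun q => μ q {ω | ℓ q ω ≤ 0 ∧ 0 ≤ u q ω}) atTop := by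
    have hopen : IsOpen {x | L x < -e n ∧ e n < U x} :=
      (isOpen_lt hL continuous_const).inter (isOpen_lt continuous_const hU)
    refine (TendstoInDistribution.le_liminf_measure_open h hopen).trans ?_
    refine le_of_le_of_eq ?_ (ENNReal.liminf_add_of_right_tendsto_zero (hbad (e n) (he_pos n)) _)
    refine liminf_le_liminf (Eventually.of_forall fun q => ?_)
    refine le_trans (measure_mono fun ω hω => ?_) (measure_union_le _ _)
    simp only [Set.mem_ofPred_eq, Set.mem_union, abs_le] at hω ⊢
    by_cases hb : (-e n ≤ ℓ q ω - L (X q ω) ∧ ℓ q ω - L (X q ω) ≤ e n) ∧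
      -e n ≤ u q ω - U (X q ω) ∧ u q ω - U (X q ω) ≤ e n
    · left; constructor <;> linarith
    · exact Or.inr hb
  have upper_bd (n : ℕ) : limsup (fun q => μ q {ω | ℓ q ω ≤ 0 ∧ 0 ≤ u q ω}) atTop ≤
      ν {x | L x ≤ e n ∧ -e n ≤ U x} := by
    have hclosed : IsClosed {x | L x ≤ e n ∧ -e n ≤ U x} :=
      (isClosed_le hL continuous_const).inter (isClosed_le continuous_const hU)
    refine le_trans (le_of_le_of_eq ?_
      (ENNReal.limsup_add_of_right_tendsto_zero (hbad (e n) (he_pos n)) _))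
      (TendstoInDistribution.limsup_measure_closed_le h hclosed)
    refine limsup_le_limsup (Eventually.of_forall fun q => ?_)
    refine le_trans (measure_mono fun ω hω => ?_) (measure_union_le _ _)
    simp only [Set.mem_ofPred_eq, Set.mem_union, abs_le] at hω ⊢
    by_cases hb : (-e n ≤ ℓ q ω - L (X q ω) ∧ ℓ q ω - L (X q ω) ≤ e n) ∧
      -e n ≤ u q ω - U (X q ω) ∧ u q ω - U (X q ω) ≤ e n
    · left; constructor <;> linarith
    · exact Or.inr hb
  refine tendsto_of_le_liminf_of_limsup_le ?_ ?_
  · have h1 : ν {x | L x ≤ 0 ∧ 0 ≤ U x} ≤ ν (⋃ n, {x | L x < -e n ∧ e n < U x}) := by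
      calc ν {x | L x ≤ 0 ∧ 0 ≤ U x}
          ≤ ν ((⋃ n, {x | L x < -e n ∧ e n < U x}) ∪ ({x | L x = 0} ∪ {x | U x = 0})) := by
            refine measure_mono fun x hx => ?_
            simp only [Set.mem_ofPred_eq, Set.mem_union, Set.mem_iUnion] at hx ⊢
            by_cases h0 : L x = 0 ∨ U x = 0
            · exact Or.inr h0
            · push Not at h0
              have hm : 0 < min (-L x) (U x) :=
                lt_min (by have := lt_of_le_of_ne hx.1 h0.1; linarith)
                  (lt_of_le_of_ne hx.2 h0.2.symm)
              obtain ⟨n, hn⟩ := (he_lim.eventually_lt_const hm).exists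
              obtain ⟨h3, h4⟩ := lt_min_iff.1 hn
              exact Or.inl ⟨n, by linarith, h4⟩
        _ ≤ ν (⋃ n, {x | L x < -e n ∧ e n < U x}) + (ν {x | L x = 0} + ν {x | U x = 0}) :=
            (measure_union_le _ _).trans (by gcongr; exact measure_union_le _ _)
        _ = _ := by rw [hL0, hU0]; simp
    refine h1.trans (le_of_tendsto' (tendsto_measure_iUnion_atTop ?_) lower_bd)
    intro n k hnk x hx
    have := he_anti.antitone hnk
    simp only [Set.mem_ofPred_eq] at hx ⊢
    constructor <;> linarith
  · have h1 : {x | L x ≤ 0 ∧ 0 ≤ U x} = ⋂ n, {x | L x ≤ e n ∧ -e n ≤ U x} := by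
      ext x
      simp only [Set.mem_ofPred_eq, Set.mem_iInter]
      refine ⟨fun hx n => ?_, fun hx => ⟨ge_of_tendsto' he_lim fun n => (hx n).1, ?_⟩⟩
      · have := he_pos n
        constructor <;> linarith
      · exact le_of_tendsto' (by simpa using he_lim.neg) fun n => (hx n).2
    rw [h1]
    refine ge_of_tendsto' (tendsto_measure_iInter_atTop (fun n => ?_) ?_ ⟨0, measure_ne_top _ _⟩)
      upper_bd
    · exact ((isClosed_le hL continuous_const).inter
        (isClosed_le continuous_const hU)).measurableSet.nullMeasurableSet
    · intro n k hnk x hx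
      have := he_anti.antitone hnk
      simp only [Set.mem_ofPred_eq] at hx ⊢
      constructor <;> linarith

lemma IICI.TendstoInProb.tendsto_measure_notMem {m : ℕ} {Ω : ℕ → Type*}
    [∀ q, MeasurableSpace (Ω q)]
    {μ : ∀ q, Measure (Ω q)} {X : ∀ q, Ω q → Matrix (Fin m) (Fin m) ℝ}
    {V : Matrix (Fin m) (Fin m) ℝ} (h : IICI.TendstoInProb μ X V)
    {N : Set (Matrix (Fin m) (Fin m) ℝ)} (hN : N ∈ 𝓝 V) :
    Tendsto (fun q => μ q {ω | X q ω ∉ N}) atTop (𝓝 0) := by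
  obtain ⟨ε, hε, hb⟩ := 
    (Metric.nhds_basis_ball (α := Fin m → Fin m → ℝ) (x := V)).mem_iff.1 hN
  have hsum : Tendsto (fun q => ∑ i, ∑ j, μ q {ω | ε ≤ |X q ω i j - V i j|}) atTop (𝓝 0) := by
    simpa using tendsto_finsetSum Finset.univ fun i _ =>
      tendsto_finsetSum Finset.univ fun j _ => h i j ε hε
  refine tendsto_of_tendsto_of_tendsto_of_le_of_le tendsto_const_nhds hsum
    (fun _ => zero_le) fun q => ?_
  calc μ q {ω | X q ω ∉ N} ≤ μ q (⋃ i, ⋃ j, {ω | ε ≤ |X q ω i j - V i j|}) := by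
        refine measure_mono fun ω hω => ?_
        by_contra hcon
        simp only [Set.mem_iUnion, Set.mem_ofPred_eq, not_exists, not_le] at hcon
        refine hω (hb ?_)
        refine Metric.mem_ball.2 ((dist_pi_lt_iff hε).2 fun i => (dist_pi_lt_iff hε).2 fun j => ?_)
        exact hcon i j
    _ ≤ _ := (measure_iUnion_fintype_le _ _).trans
        (Finset.sum_le_sum fun i _ => measure_iUnion_fintype_le _ _)

/-- An event that is eventually excluded, uniformly on bounded sets of `X`, by closeness of `W` to
`V` and by the behaviour of `t` along `H`, has vanishing probability. -/
lemma tendsto_measure_not_of_eventually {m : ℕ} {E : Type*} [NormedAddCommGroup E]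
    [MeasurableSpace E] [BorelSpace E] {Ω : ℕ → Type*}
    [∀ q, MeasurableSpace (Ω q)]
    {μ : ∀ q, Measure (Ω q)} [∀ q, IsProbabilityMeasure (μ q)] {ν : Measure E}
    [IsProbabilityMeasure ν] {X : ∀ q, Ω q → E}
    (hX : TendstoInDistribution X atTop id μ ν) {W : ∀ q, Ω q → Matrix (Fin m) (Fin m) ℝ}
    {V : Matrix (Fin m) (Fin m) ℝ} (hW : IICI.TendstoInProb μ W V)
    (hsymm : ∀ q, ∀ᵐ ω ∂(μ q), (W q ω).IsSymm) {t : ℕ → ℝ} {H : Filter ℝ}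
    (ht : Tendsto t atTop H) {p : E → Matrix (Fin m) (Fin m) ℝ → ℝ → Prop}
    (hp : ∀ M : ℝ, ∀ᶠ w in 𝓝 V ×ˢ H, w.1.IsSymm → ∀ x, ‖x‖ ≤ M → p x w.1 w.2) :
    Tendsto (fun q => μ q {ω | ¬ p (X q ω) (W q ω) (t q)}) atTop (𝓝 0) := by
  -- Tightness: off the event `‖X‖ ≥ M`, failure forces `W` out of a neighbourhood of `V`, which has
  -- vanishing probability. Then `M → ∞`.
  have key (M : ℕ) : limsup (fun q => μ q {ω | ¬ p (X q ω) (W q ω) (t q)}) atTop ≤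
      ν {x | (M : ℝ) ≤ ‖x‖} := by
    obtain ⟨N, hN, T, hT, hNT⟩ := eventually_prod_iff.1 (hp M)
    have hcl : IsClosed {x : E | (M : ℝ) ≤ ‖x‖} := isClosed_le continuous_const continuous_norm
    refine le_trans (le_of_le_of_eq ?_
      (ENNReal.limsup_add_of_right_tendsto_zero (hW.tendsto_measure_notMem hN) _))
      (TendstoInDistribution.limsup_measure_closed_le hX hcl)
    refine limsup_le_limsup ?_
    filter_upwards [ht.eventually hT] with q hq
    refine le_trans (measure_mono_ae ?_) (measure_union_le _ _)
    filter_upwards [hsymm q] with ω hω hbad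
    by_contra hcon
    have hcon' : ¬ ((M : ℝ) ≤ ‖X q ω‖ ∨ ¬ N (W q ω)) := hcon
    rw [not_or, not_not, not_le] at hcon'
    exact hbad (hNT hcon'.2 hq hω _ hcon'.1.le)
  have hlim : Tendsto (fun M : ℕ => ν {x | (M : ℝ) ≤ ‖x‖}) atTop (𝓝 0) := by
    have h1 : (⋂ M : ℕ, {x : E | (M : ℝ) ≤ ‖x‖}) = ∅ := by
      ext x
      simp only [Set.mem_iInter, Set.mem_ofPred_eq, Set.mem_empty_iff_false, iff_false, not_forall,
        not_le]
      exact exists_nat_gt _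
    rw [← measure_empty (μ := ν), ← h1]
    refine tendsto_measure_iInter_atTop (fun n => ?_) ?_ ⟨0, measure_ne_top _ _⟩
    · exact (isClosed_le continuous_const continuous_norm).measurableSet.nullMeasurableSet
    · intro n k hnk x hx
      exact le_trans (Nat.cast_le.2 hnk) (show (k : ℝ) ≤ ‖x‖ from hx)
  exact tendsto_of_le_liminf_of_limsup_le zero_le (ge_of_tendsto' hlim key)

/-! ### The bilinear form -/

namespace IICI

variable {k : ℕ}

lemma form_sub_left (V : Matrix (Fin k) (Fin k) ℝ) (x y z : EuclideanSpace ℝ (Fin k)) :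
    form V (x - y) z = form V x z - form V y z := by
  simp [form, sub_dotProduct]

lemma form_sub_right (V : Matrix (Fin k) (Fin k) ℝ) (x y z : EuclideanSpace ℝ (Fin k)) :
    form V x (y - z) = form V x y - form V x z := by
  simp [form, Matrix.mulVec_sub, dotProduct_sub]

lemma form_smul_left (V : Matrix (Fin k) (Fin k) ℝ) (c : ℝ) (x y : EuclideanSpace ℝ (Fin k)) :
    form V (c • x) y = c * form V x y := by
  simp [form, smul_dotProduct]

lemma form_smul_right (V : Matrix (Fin k) (Fin k) ℝ) (c : ℝ) (x y : EuclideanSpace ℝ (Fin k)) :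
    form V x (c • y) = c * form V x y := by
  simp [form, Matrix.mulVec_smul, dotProduct_smul]

lemma form_comm {V : Matrix (Fin k) (Fin k) ℝ} (hV : V.IsSymm) (x y : EuclideanSpace ℝ (Fin k)) :
    form V x y = form V y x := by
  unfold form
  rw [Matrix.dotProduct_mulVec, ← Matrix.mulVec_transpose, hV.eq, dotProduct_comm]

lemma form_pos {V : Matrix (Fin k) (Fin k) ℝ} (hV : V.PosDef) {x : EuclideanSpace ℝ (Fin k)}
    (hx : x ≠ 0) : 0 < form V x x := by
  have h : x.ofLp ≠ 0 := fun h => hx (by ext i; simp [h])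
  simpa [form] using hV.dotProduct_mulVec_pos h

lemma continuous_form (x y : EuclideanSpace ℝ (Fin k)) :
    Continuous fun V : Matrix (Fin k) (Fin k) ℝ => form V x y := by
  unfold form
  fun_prop

variable [NeZero k]

/-- The variance `e₁'Ve₁ - e₁'Va (a'Va)⁻¹ a'Ve₁` of the first coordinate of the equality-imposed
estimator. -/
noncomputable def residual (a : EuclideanSpace ℝ (Fin k)) (V : Matrix (Fin k) (Fin k) ℝ) : ℝ :=
  form V e₁ e₁ - form V e₁ a * (form V a a)⁻¹ * form V a e₁

lemma inner_e₁ (x : EuclideanSpace ℝ (Fin k)) : inner ℝ (e₁ : EuclideanSpace ℝ (Fin k)) x = x 0 := by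
  simpa [e₁] using EuclideanSpace.inner_single_left (0 : Fin k) (1 : ℝ) x

lemma e₁_ne_zero : (e₁ : EuclideanSpace ℝ (Fin k)) ≠ 0 := by
  simp [e₁]

lemma form_e₁ (V : Matrix (Fin k) (Fin k) ℝ) (a : EuclideanSpace ℝ (Fin k)) :
    form V e₁ a = (V *ᵥ a.ofLp) 0 := by
  simp [form, e₁]

/-! ### Positivity of the residual variance. -/

section PosDef

variable {V : Matrix (Fin k) (Fin k) ℝ} {a : EuclideanSpace ℝ (Fin k)}

lemma ne_zero_of_ne_smul_e₁ (ha : (a 0) • (e₁ : EuclideanSpace ℝ (Fin k)) ≠ a) : a ≠ 0 := by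
  rintro rfl
  simp at ha

/-- The vector is the component of `e₁` that is `V`-orthogonal to `a`; the residual is its squared
`V`-norm. -/
lemma form_residual_vector (hV : V.PosDef)
    (ha : (a 0) • (e₁ : EuclideanSpace ℝ (Fin k)) ≠ a) :
    form V (e₁ - ((form V a a)⁻¹ * form V e₁ a) • a)
      (e₁ - ((form V a a)⁻¹ * form V e₁ a) • a) = residual a V := by
  have hw := form_pos hV (ne_zero_of_ne_smul_e₁ ha)
  have hs : V.IsSymm := hV.isHermitian
  simp only [form_sub_left, form_sub_right, form_smul_left, form_smul_right, residual,
    form_comm hs a e₁]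
  field_simp
  ring

lemma residual_pos (hV : V.PosDef) (ha : (a 0) • (e₁ : EuclideanSpace ℝ (Fin k)) ≠ a) :
    0 < residual a V := by
  rw [← form_residual_vector hV ha]
  refine form_pos hV fun h => ha ?_
  set c := (form V a a)⁻¹ * form V e₁ a
  have h1 : (e₁ : EuclideanSpace ℝ (Fin k)) = c • a := sub_eq_zero.1 h
  have h2 : 1 = c * a 0 := by
    have := congrArg (fun x : EuclideanSpace ℝ (Fin k) => x 0) h1
    simpa [e₁] using this
  rw [h1, smul_smul, mul_comm, ← h2, one_smul]

lemma continuousAt_residual (hw : form V a a ≠ 0) : ContinuousAt (residual a) V := by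
  unfold residual
  have := fun x y : EuclideanSpace ℝ (Fin k) => (continuous_form x y).continuousAt (x := V)
  exact (this _ _).sub (((this _ _).mul ((this _ _).inv₀ hw)).mul (this _ _))

end PosDef

/-! ### Scaled endpoints -/

/-- The rescaled threshold. -/
noncomputable def scaledThreshold (v w σ s z : ℝ) : ℝ :=
  open Classical in if v ≠ 0 then v⁻¹ * w * (σ - s) * z else 0

/-- The rescaled lower endpoint. -/
noncomputable def scaledLower (v w σ s z x T : ℝ) : ℝ :=
  open Classical in if T ≤ scaledThreshold v w σ s z then x - σ * z else x - w⁻¹ * T * v - s * z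

/-- The rescaled upper endpoint. -/
noncomputable def scaledUpper (v w σ s z x T : ℝ) : ℝ :=
  open Classical in if T ≤ -scaledThreshold v w σ s z then x + σ * z else x - w⁻¹ * T * v + s * z

/-- The minimum of two numbers if `0 ≤ v`, and their maximum otherwise. -/
noncomputable def signedMin (v A B : ℝ) : ℝ := if 0 ≤ v then min A B else max A B

/-- The threshold is the crossing point of the two lower candidates, so comparing `T` with it
compares the candidates. -/
lemma le_scaledThreshold_iff {v w σ s z T : ℝ} (hv : 0 < v) (hw : 0 < w) :
    T ≤ scaledThreshold v w σ s z ↔ w⁻¹ * T * v ≤ (σ - s) * z := by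
  rw [scaledThreshold, if_pos hv.ne']
  have h1 : w⁻¹ * T * v = T * (w⁻¹ * v) := by ring
  have h2 : v⁻¹ * w * (σ - s) * z = ((σ - s) * z) / (w⁻¹ * v) := by field_simp
  rw [h1, h2, le_div_iff₀ (by positivity)]

lemma scaledThreshold_neg (v w σ s z : ℝ) :
    scaledThreshold (-v) w σ s z = -scaledThreshold v w σ s z := by
  unfold scaledThreshold
  by_cases hv : v = 0
  · simp [hv]
  · simp [hv, inv_neg]

lemma scaledLower_of_pos {v w σ s z x T : ℝ} (hv : 0 < v) (hw : 0 < w) :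
    scaledLower v w σ s z x T = min (x - σ * z) (x - w⁻¹ * T * v - s * z) := by
  unfold scaledLower
  simp only [le_scaledThreshold_iff hv hw]
  split_ifs with h
  · rw [min_eq_left]; linarith
  · rw [min_eq_right]; linarith

lemma scaledUpper_of_pos {v w σ s z x T : ℝ} (hv : 0 < v) (hw : 0 < w) :
    scaledUpper v w σ s z x T = min (x + σ * z) (x - w⁻¹ * T * v + s * z) := by
  have h0 : T ≤ -scaledThreshold v w σ s z ↔ w⁻¹ * T * v ≤ -((σ - s) * z) := by
    have : -scaledThreshold v w σ s z = scaledThreshold v w σ s (-z) := by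
      unfold scaledThreshold; split_ifs <;> ring
    rw [this, le_scaledThreshold_iff hv hw, mul_neg]
  unfold scaledUpper
  simp only [h0]
  split_ifs with h
  · rw [min_eq_left]; linarith
  · rw [min_eq_right]; linarith

lemma scaledLower_of_neg {v w σ s z x T : ℝ} (hv : v < 0) (hw : 0 < w) :
    scaledLower v w σ s z x T = max (x - σ * z) (x - w⁻¹ * T * v - s * z) := by
  have h0 : T ≤ scaledThreshold v w σ s z ↔ w⁻¹ * T * v ≥ (σ - s) * z := by
    have : scaledThreshold v w σ s z = scaledThreshold (-v) w σ s (-z) := by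
      -- Flipping the signs of both `v` and `z` leaves the threshold unchanged and reduces to a
      -- positive `v`.
      rw [scaledThreshold_neg]; unfold scaledThreshold; split_ifs <;> ring
    rw [this, le_scaledThreshold_iff (neg_pos.2 hv) hw]
    constructor <;> intro h <;> linarith
  unfold scaledLower
  simp only [h0]
  split_ifs with h
  · rw [max_eq_left]; linarith
  · rw [max_eq_right]; linarith

lemma scaledUpper_of_neg {v w σ s z x T : ℝ} (hv : v < 0) (hw : 0 < w) :
    scaledUpper v w σ s z x T = max (x + σ * z) (x - w⁻¹ * T * v + s * z) := by
  have h0 : T ≤ -scaledThreshold v w σ s z ↔ w⁻¹ * T * v ≥ -((σ - s) * z) := by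
    rw [← scaledThreshold_neg, le_scaledThreshold_iff (neg_pos.2 hv) hw]
    constructor <;> intro h <;> linarith
  unfold scaledUpper
  simp only [h0]
  split_ifs with h
  · rw [max_eq_left]; linarith
  · rw [max_eq_right]; linarith

lemma abs_signedMin_sub_le {v A B A' B' ε : ℝ} (hA : |A' - A| ≤ ε) (hB : |B' - B| ≤ ε) :
    |signedMin v A' B' - signedMin v A B| ≤ ε := by
  unfold signedMin
  split_ifs
  · exact (abs_min_sub_min_le_max _ _ _ _).trans (max_le hA hB)
  · exact (abs_max_sub_max_le_max _ _ _ _).trans (max_le hA hB)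

lemma signedMin_eq_of_sign {v v' A B : ℝ} (hv : 0 < v * v') :
    signedMin v A B = if 0 < v' then min A B else max A B := by
  unfold signedMin
  rcases lt_trichotomy v' 0 with h | rfl | h
  · rw [if_neg (by nlinarith), if_neg h.not_gt]
  · simp at hv
  · rw [if_pos (by nlinarith), if_pos h]

/-- Here `v` is the limit and `v'` its estimate. For `v ≠ 0` the signs agree, so both sides are the
same minimum or maximum; for `v = 0` the sign of `v'` is uncontrolled, but both branches are close
to the common value. -/
lemma abs_scaledLower_sub_le {v v' w' σ' s' z x T A B ε : ℝ} (hw' : 0 < w')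
    (hv : v ≠ 0 → 0 < v * v') (hv0 : v = 0 → A = B) (hA : |x - σ' * z - A| ≤ ε)
    (hB : |x - w'⁻¹ * T * v' - s' * z - B| ≤ ε) :
    |scaledLower v' w' σ' s' z x T - signedMin v A B| ≤ ε := by
  by_cases h0 : v = 0
  · have hAB := hv0 h0
    have : signedMin v A B = A := by simp [signedMin, hAB]
    rw [this]
    unfold scaledLower
    split_ifs
    · exact hA
    · rwa [hAB]
  · refine le_trans (le_of_eq ?_) (abs_signedMin_sub_le (v := v) hA hB)
    rw [signedMin_eq_of_sign (hv h0) (A := x - σ' * z)]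
    have : v' ≠ 0 := by rintro rfl; simpa using hv h0
    split_ifs with h
    · rw [scaledLower_of_pos h hw']
    · rw [scaledLower_of_neg (lt_of_le_of_ne (not_lt.1 h) this) hw']

lemma abs_scaledUpper_sub_le {v v' w' σ' s' z x T A B ε : ℝ} (hw' : 0 < w')
    (hv : v ≠ 0 → 0 < v * v') (hv0 : v = 0 → A = B) (hA : |x + σ' * z - A| ≤ ε)
    (hB : |x - w'⁻¹ * T * v' + s' * z - B| ≤ ε) :
    |scaledUpper v' w' σ' s' z x T - signedMin v A B| ≤ ε := by
  by_cases h0 : v = 0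
  · have hAB := hv0 h0
    have : signedMin v A B = A := by simp [signedMin, hAB]
    rw [this]
    unfold scaledUpper
    split_ifs
    · exact hA
    · rwa [hAB]
  · refine le_trans (le_of_eq ?_) (abs_signedMin_sub_le (v := v) hA hB)
    rw [signedMin_eq_of_sign (hv h0) (A := x + σ' * z)]
    have : v' ≠ 0 := by rintro rfl; simpa using hv h0
    split_ifs with h
    · rw [scaledUpper_of_pos h hw']
    · rw [scaledUpper_of_neg (lt_of_le_of_ne (not_lt.1 h) this) hw']

/-- Since `σ - s = v² / (w (σ + s))`, the threshold is `v z / (σ + s)`: the factor `v⁻¹` causes no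
blow-up near `v = 0`. -/
lemma abs_scaledThreshold_le {v w D σ2 z : ℝ} (hw : 0 < w) (hz : 0 ≤ z) (hσ : 0 < σ2)
    (hD : 0 ≤ D) (hDσ : D = σ2 - v * w⁻¹ * v) :
    |scaledThreshold v w √σ2 √D z| ≤ |v| * z / √σ2 := by
  unfold scaledThreshold
  have h1 := Real.sqrt_pos.2 hσ
  split_ifs with hv
  · have h2 : v⁻¹ * w * (√σ2 - √D) * z = v * z / (√σ2 + √D) := by
      have h3 : (√σ2 - √D) * (√σ2 + √D) = v * w⁻¹ * v := by
        have := Real.mul_self_sqrt hσ.le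
        have := Real.mul_self_sqrt hD
        linarith
      have h4 : 0 < √σ2 + √D := by positivity
      rw [eq_div_iff h4.ne']
      calc _ = v⁻¹ * w * ((√σ2 - √D) * (√σ2 + √D)) * z := by ring
        _ = v * z := by rw [h3]; field_simp
    rw [h2, abs_div, abs_mul, abs_of_nonneg hz, abs_of_pos (a := √σ2 + √D) (by positivity)]
    gcongr
    linarith [Real.sqrt_nonneg D]
  · simp only [abs_zero]
    positivity

/-- The first coordinate of the true parameter is covered if and only if the rescaled endpoints
enclose `0`. -/
lemma mem_interval_iff (n : ℕ+) (α : ℝ) (a : EuclideanSpace ℝ (Fin k)) (b : ℝ)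
    (t θ : EuclideanSpace ℝ (Fin k)) (V : Matrix (Fin k) (Fin k) ℝ) :
    θ 0 ∈ interval n α a b t V ↔
      scaledLower (form V e₁ a) (form V a a) √(form V e₁ e₁) √(residual a V)
        (normalQuantile (1 - α / 2)) ((√(n : ℝ) • (t - θ)) 0)
        (inner ℝ a (√(n : ℝ) • (t - θ)) + √(n : ℝ) * g a b θ) ≤ 0 ∧
      0 ≤ scaledUpper (form V e₁ a) (form V a a) √(form V e₁ e₁) √(residual a V)
        (normalQuantile (1 - α / 2)) ((√(n : ℝ) • (t - θ)) 0)
        (inner ℝ a (√(n : ℝ) • (t - θ)) + √(n : ℝ) * g a b θ) := by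
  have hr : 0 < √(n : ℝ) := Real.sqrt_pos.2 (by exact_mod_cast n.pos)
  have hT : inner ℝ a (√(n : ℝ) • (t - θ)) + √(n : ℝ) * g a b θ = √(n : ℝ) * g a b t := by
    have h1 (x : EuclideanSpace ℝ (Fin k)) : inner ℝ a x = a.ofLp ⬝ᵥ x.ofLp := by
      rw [EuclideanSpace.inner_eq_star_dotProduct, dotProduct_comm]
      simp
    rw [inner_smul_right, inner_sub_right, h1, h1, g, g]
    ring
  have hthr : threshold n α a V = (√(n : ℝ))⁻¹ * scaledThreshold (form V e₁ a) (form V a a)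
      √(form V e₁ e₁) √(residual a V) (normalQuantile (1 - α / 2)) := by
    unfold threshold scaledThreshold sHat sEq
    split_ifs
    · unfold residual; ring
    · simp
  have hx : (√(n : ℝ) • (t - θ)) 0 = √(n : ℝ) * (t 0 - θ 0) := by simp
  have heq : eqEstimator a b t V 0 =
      t 0 - (form V a a)⁻¹ * g a b t * form V e₁ a := by
    simp [eqEstimator, form_e₁]
  rw [hT, hx]
  have hlow : scaledLower (form V e₁ a) (form V a a) √(form V e₁ e₁) √(residual a V)
      (normalQuantile (1 - α / 2)) (√(n : ℝ) * (t 0 - θ 0)) (√(n : ℝ) * g a b t) =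
      √(n : ℝ) * (lower n α a b t V - θ 0) := by
    unfold lower scaledLower
    rw [hthr]
    simp only [le_inv_mul_iff₀ hr]
    split_ifs
    · unfold sHat; field_simp; ring
    · rw [heq]; unfold sEq residual; field_simp; ring
  have hup : scaledUpper (form V e₁ a) (form V a a) √(form V e₁ e₁) √(residual a V)
      (normalQuantile (1 - α / 2)) (√(n : ℝ) * (t 0 - θ 0)) (√(n : ℝ) * g a b t) =
      √(n : ℝ) * (upper n α a b t V - θ 0) := by
    unfold upper scaledUpper
    rw [hthr, ← mul_neg]
    simp only [le_inv_mul_iff₀ hr]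
    split_ifs
    · unfold sHat; field_simp; ring
    · rw [heq]; unfold sEq residual; field_simp; ring
  rw [hlow, hup, interval, Set.mem_Icc, mul_nonneg_iff_of_pos_left hr, sub_nonneg,
    mul_nonpos_iff_pos_imp_nonpos]
  constructor
  · rintro ⟨h1, h2⟩
    exact ⟨⟨fun _ => by linarith, fun h => hr.le⟩, h2⟩
  · rintro ⟨⟨h1, -⟩, h2⟩
    exact ⟨by linarith [h1 hr], h2⟩

end IICI

/-! ### The normal quantile -/

namespace IICI

lemma continuous_cdf_gaussianReal : Continuous (cdf (gaussianReal 0 1)) := by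
  have := nullSingletonClass_gaussianReal (μ := 0) (one_ne_zero (α := NNReal))
  rw [continuous_iff_continuousAt]
  intro x
  rw [(cdf (gaussianReal 0 1)).mono.continuousAt_iff_leftLim_eq_rightLim,
    StieltjesFunction.rightLim_eq]
  have h := StieltjesFunction.measure_singleton (cdf (gaussianReal 0 1)) x
  rw [measure_cdf, measure_singleton, eq_comm, ENNReal.ofReal_eq_zero] at h
  exact le_antisymm ((cdf (gaussianReal 0 1)).mono.leftLim_le le_rfl) (by linarith)

lemma nonempty_setOf_le_cdf {p : ℝ} (hp : p < 1) :
    {x : ℝ | p ≤ cdf (gaussianReal 0 1) x}.Nonempty :=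
  (((tendsto_cdf_atTop (gaussianReal 0 1)).eventually_const_lt hp).exists).imp fun _ h => h.le

/-- Continuity of the cdf makes the infimum attained; points to its left have cdf below `p`, which
bounds the value from above. -/
lemma cdf_normalQuantile {p : ℝ} (hp0 : 0 < p) (hp1 : p < 1) :
    cdf (gaussianReal 0 1) (normalQuantile p) = p := by
  have hbdd : BddBelow {x : ℝ | p ≤ cdf (gaussianReal 0 1) x} := by
    obtain ⟨y, hy⟩ := ((tendsto_cdf_atBot (gaussianReal 0 1)).eventually_lt_const hp0).exists
    refine ⟨y, fun x hx => ?_⟩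
    by_contra! hxy
    exact absurd (monotone_cdf (gaussianReal 0 1) hxy.le) (not_le.2 (hy.trans_le hx))
  have hmem : p ≤ cdf (gaussianReal 0 1) (normalQuantile p) :=
    (isClosed_le continuous_const continuous_cdf_gaussianReal).csInf_mem
      (nonempty_setOf_le_cdf hp1) hbdd
  refine le_antisymm ?_ hmem
  refine le_of_tendsto (x := 𝓝[<] normalQuantile p)
    (continuous_cdf_gaussianReal.continuousAt.tendsto.mono_left nhdsWithin_le_nhds) ?_
  filter_upwards [self_mem_nhdsWithin] with y hy
  by_contra! h
  exact absurd (csInf_le hbdd h.le) (not_le.2 hy)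

lemma cdf_gaussianReal_zero_le : cdf (gaussianReal 0 1) 0 ≤ 1 / 2 := by
  have := nullSingletonClass_gaussianReal (μ := 0) (one_ne_zero (α := NNReal))
  have h1 : (gaussianReal 0 1).real (Set.Iic 0) = (gaussianReal 0 1).real (Set.Ici 0) := by
    have h : (gaussianReal 0 1).map (fun x => -x) = gaussianReal 0 1 := by
      simp [gaussianReal_map_neg]
    rw [measureReal_def, measureReal_def]
    congr 1
    conv_lhs => rw [← h, Measure.map_apply measurable_neg measurableSet_Iic]
    congr 1
    ext x
    simp
  have h2 := measureReal_union_add_inter (μ := gaussianReal 0 1) (s := Set.Iic 0)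
    (t := Set.Ici (0 : ℝ)) measurableSet_Ici
  rw [Set.Iic_union_Ici, Set.Iic_inter_Ici, Set.Icc_self, probReal_univ, ← h1] at h2
  have h3 : (gaussianReal 0 1).real {0} = 0 := by simp [measureReal_def]
  rw [cdf_eq_real]
  linarith

lemma normalQuantile_nonneg {p : ℝ} (hp : 1 / 2 < p) (hp1 : p < 1) : 0 ≤ normalQuantile p := by
  refine le_csInf (nonempty_setOf_le_cdf hp1) fun x hx => ?_
  by_contra! h
  have h1 := monotone_cdf (gaussianReal 0 1) h.le
  have h2 : p ≤ cdf (gaussianReal 0 1) x := hx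
  linarith [cdf_gaussianReal_zero_le]

/-! ### Limits of the rescaled endpoints -/

lemma tendsto_sqrt_form {k : ℕ} (V : Matrix (Fin k) (Fin k) ℝ) (x y : EuclideanSpace ℝ (Fin k)) :
    Tendsto (fun W => √(form W x y)) (𝓝 V) (𝓝 √(form V x y)) :=
  ((continuous_form x y).tendsto V).sqrt

lemma abs_inner_le {k : ℕ} {a x : EuclideanSpace ℝ (Fin k)} {M : ℝ} (hx : ‖x‖ ≤ M) :
    |inner ℝ a x| ≤ ‖a‖ * M :=
  (abs_real_inner_le_norm a x).trans (by gcongr)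

section Limits

variable {k : ℕ} [NeZero k] {V : Matrix (Fin k) (Fin k) ℝ} {a : EuclideanSpace ℝ (Fin k)} {z : ℝ}

/-- The limiting lower endpoint when `√n g(θ)` tends to `h`. -/
noncomputable def limitLower (V : Matrix (Fin k) (Fin k) ℝ) (a : EuclideanSpace ℝ (Fin k))
    (z h : ℝ) (x : EuclideanSpace ℝ (Fin k)) : ℝ :=
  signedMin (form V e₁ a) (x 0 - √(form V e₁ e₁) * z)
    (x 0 - (form V a a)⁻¹ * (inner ℝ a x + h) * form V e₁ a - √(residual a V) * z)

/-- The limiting upper endpoint when `√n g(θ)` tends to `h`. -/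
noncomputable def limitUpper (V : Matrix (Fin k) (Fin k) ℝ) (a : EuclideanSpace ℝ (Fin k))
    (z h : ℝ) (x : EuclideanSpace ℝ (Fin k)) : ℝ :=
  signedMin (form V e₁ a) (x 0 + √(form V e₁ e₁) * z)
    (x 0 - (form V a a)⁻¹ * (inner ℝ a x + h) * form V e₁ a + √(residual a V) * z)

lemma continuous_signedMin {E : Type*} [TopologicalSpace E] (v : ℝ) {f g : E → ℝ}
    (hf : Continuous f) (hg : Continuous g) : Continuous fun x => signedMin v (f x) (g x) := by
  unfold signedMin
  split_ifs
  · exact hf.min hg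
  · exact hf.max hg

lemma continuous_limitLower (h : ℝ) : Continuous (limitLower V a z h) := by
  unfold limitLower
  exact continuous_signedMin _ (by fun_prop) (by fun_prop)

lemma continuous_limitUpper (h : ℝ) : Continuous (limitUpper V a z h) := by
  unfold limitUpper
  exact continuous_signedMin _ (by fun_prop) (by fun_prop)

/-- The candidates depend on `x` through `x 0`, with the same coefficient `1` on both sides, and
through `inner ℝ a x`, with a coefficient converging as `W → V`. This gives uniformity on bounded
sets. -/
lemma eventually_abs_sub_limit_le (hV : V.PosDef)
    (ha : (a 0) • (e₁ : EuclideanSpace ℝ (Fin k)) ≠ a) (hz : 0 ≤ z) (h : ℝ) {ε : ℝ} (hε : 0 < ε)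
    (M : ℝ) :
    ∀ᶠ w : Matrix (Fin k) (Fin k) ℝ × ℝ in 𝓝 V ×ˢ 𝓝 h, w.1.IsSymm →
      ∀ x : EuclideanSpace ℝ (Fin k), ‖x‖ ≤ M →
      |scaledLower (form w.1 e₁ a) (form w.1 a a) √(form w.1 e₁ e₁) √(residual a w.1) z (x 0)
        (inner ℝ a x + w.2) - limitLower V a z h x| ≤ ε ∧
      |scaledUpper (form w.1 e₁ a) (form w.1 a a) √(form w.1 e₁ e₁) √(residual a w.1) z (x 0)
        (inner ℝ a x + w.2) - limitUpper V a z h x| ≤ ε := by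
  have hw := form_pos hV (ne_zero_of_ne_smul_e₁ ha)
  have hfst : Tendsto (Prod.fst : Matrix (Fin k) (Fin k) ℝ × ℝ → _) (𝓝 V ×ˢ 𝓝 h) (𝓝 V) :=
    tendsto_fst
  have hsnd : Tendsto (Prod.snd : Matrix (Fin k) (Fin k) ℝ × ℝ → _) (𝓝 V ×ˢ 𝓝 h) (𝓝 h) :=
    tendsto_snd
  have hσ := (tendsto_sqrt_form V e₁ e₁).comp hfst
  have hs := (continuousAt_residual hw.ne').tendsto.sqrt.comp hfst
  have hv := ((continuous_form e₁ a).tendsto V).comp hfst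
  have hwt := ((continuous_form a a).tendsto V).comp hfst
  have hr := (hwt.inv₀ hw.ne').mul hv
  have hrh := hr.mul hsnd
  have hb1 : Tendsto (fun w : Matrix (Fin k) (Fin k) ℝ × ℝ =>
      |√(form w.1 e₁ e₁) - √(form V e₁ e₁)| * z) (𝓝 V ×ˢ 𝓝 h) (𝓝 0) := by
    have := ((hσ.sub_const √(form V e₁ e₁)).abs).mul_const z
    simpa using this
  have hb2 : Tendsto (fun w : Matrix (Fin k) (Fin k) ℝ × ℝ =>
      |(form w.1 a a)⁻¹ * form w.1 e₁ a - (form V a a)⁻¹ * form V e₁ a| * (‖a‖ * M) +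
      |(form w.1 a a)⁻¹ * form w.1 e₁ a * w.2 - (form V a a)⁻¹ * form V e₁ a * h| +
      |√(residual a w.1) - √(residual a V)| * z) (𝓝 V ×ˢ 𝓝 h) (𝓝 0) := by
    have := ((((hr.sub_const ((form V a a)⁻¹ * form V e₁ a)).abs).mul_const (‖a‖ * M)).add
      ((hrh.sub_const ((form V a a)⁻¹ * form V e₁ a * h)).abs)).add
      (((hs.sub_const √(residual a V)).abs).mul_const z)
    simpa using this
  have hsign : ∀ᶠ w : Matrix (Fin k) (Fin k) ℝ × ℝ in 𝓝 V ×ˢ 𝓝 h,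
      form V e₁ a ≠ 0 → 0 < form V e₁ a * form w.1 e₁ a := by
    by_cases h0 : form V e₁ a = 0
    · simp [h0]
    · filter_upwards [(hv.const_mul (form V e₁ a)).eventually_const_lt
        (mul_self_pos.2 h0)] with w hw _ using hw
  have hzero : form V e₁ a = 0 → √(residual a V) = √(form V e₁ e₁) := by
    intro h0
    simp [residual, h0]
  filter_upwards [hwt.eventually_const_lt hw, hsign, hb1.eventually_le_const hε,
    hb2.eventually_le_const hε] with w hw' hsw h1 h2 _ x hx
  have hax := abs_inner_le (a := a) hx
  have key : |(form V a a)⁻¹ * (inner ℝ a x + h) * form V e₁ a -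
      (form w.1 a a)⁻¹ * (inner ℝ a x + w.2) * form w.1 e₁ a| ≤
      |(form w.1 a a)⁻¹ * form w.1 e₁ a - (form V a a)⁻¹ * form V e₁ a| * (‖a‖ * M) +
      |(form w.1 a a)⁻¹ * form w.1 e₁ a * w.2 - (form V a a)⁻¹ * form V e₁ a * h| := by
    rw [abs_sub_comm]
    calc _ = |((form w.1 a a)⁻¹ * form w.1 e₁ a - (form V a a)⁻¹ * form V e₁ a) * inner ℝ a x +
          ((form w.1 a a)⁻¹ * form w.1 e₁ a * w.2 - (form V a a)⁻¹ * form V e₁ a * h)| := by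
            congr 1; ring
      _ ≤ _ := by
        refine (abs_add_le _ _).trans ?_
        rw [abs_mul]
        gcongr
  have h3 : |√(residual a w.1) - √(residual a V)| * z =
      |(√(residual a w.1) - √(residual a V)) * z| := by rw [abs_mul, abs_of_nonneg hz]
  have h4 : |√(form w.1 e₁ e₁) - √(form V e₁ e₁)| * z =
      |(√(form w.1 e₁ e₁) - √(form V e₁ e₁)) * z| := by rw [abs_mul, abs_of_nonneg hz]
  rw [h4, abs_le] at h1
  rw [h3] at h2
  have k1 := abs_le.1 key
  have k2 := abs_le.1 (le_refl |(√(residual a w.1) - √(residual a V)) * z|)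
  constructor
  · refine abs_scaledLower_sub_le hw' hsw (fun h0 => ?_) ?_ ?_
    · rw [hzero h0, h0]; ring
    · rw [abs_le]; constructor <;> linarith
    · rw [abs_le]; constructor <;> linarith
  · refine abs_scaledUpper_sub_le hw' hsw (fun h0 => ?_) ?_ ?_
    · rw [hzero h0, h0]; ring
    · rw [abs_le]; constructor <;> linarith
    · rw [abs_le]; constructor <;> linarith

lemma eventually_abs_sub_limit_le_atBot (hV : V.PosDef)
    (ha : (a 0) • (e₁ : EuclideanSpace ℝ (Fin k)) ≠ a) (hz : 0 ≤ z) {ε : ℝ} (hε : 0 < ε)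
    (M : ℝ) :
    ∀ᶠ w : Matrix (Fin k) (Fin k) ℝ × ℝ in 𝓝 V ×ˢ atBot, w.1.IsSymm →
      ∀ x : EuclideanSpace ℝ (Fin k), ‖x‖ ≤ M →
      |scaledLower (form w.1 e₁ a) (form w.1 a a) √(form w.1 e₁ e₁) √(residual a w.1) z (x 0)
        (inner ℝ a x + w.2) - (x 0 - √(form V e₁ e₁) * z)| ≤ ε ∧
      |scaledUpper (form w.1 e₁ a) (form w.1 a a) √(form w.1 e₁ e₁) √(residual a w.1) z (x 0)
        (inner ℝ a x + w.2) - (x 0 + √(form V e₁ e₁) * z)| ≤ ε := by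
  have hw := form_pos hV (ne_zero_of_ne_smul_e₁ ha)
  have hσ0 := form_pos hV (e₁_ne_zero (k := k))
  have hσ := tendsto_sqrt_form V e₁ e₁
  have hb1 : Tendsto (fun W => |√(form W e₁ e₁) - √(form V e₁ e₁)| * z) (𝓝 V) (𝓝 0) := by
    have := ((hσ.sub_const √(form V e₁ e₁)).abs).mul_const z
    simpa using this
  have hthr : Tendsto (fun W => |form W e₁ a| * z / √(form W e₁ e₁)) (𝓝 V)
      (𝓝 (|form V e₁ a| * z / √(form V e₁ e₁))) :=
    (((continuous_form e₁ a).tendsto V).abs.mul_const z).div hσ (Real.sqrt_pos.2 hσ0).ne'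
  -- `K` bounds the absolute threshold for matrices near `V`, so `T ≤ -K` selects the usual endpoint
  -- on both sides.
  set K := |form V e₁ a| * z / √(form V e₁ e₁) + 1
  have hev : ∀ᶠ W in 𝓝 V, 0 < form W a a ∧ 0 < form W e₁ e₁ ∧ 0 < residual a W ∧
      |√(form W e₁ e₁) - √(form V e₁ e₁)| * z ≤ ε ∧
      |form W e₁ a| * z / √(form W e₁ e₁) ≤ K := by
    filter_upwards [((continuous_form a a).tendsto V).eventually_const_lt hw,
      ((continuous_form e₁ e₁).tendsto V).eventually_const_lt hσ0,
      (continuousAt_residual hw.ne').tendsto.eventually_const_lt (residual_pos hV ha),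
      hb1.eventually_le_const hε, hthr.eventually_le_const (lt_add_one _)] with W h1 h2 h3 h4 h5
    exact ⟨h1, h2, h3, h4, h5⟩
  filter_upwards [hev.prod_mk (eventually_le_atBot (-K - ‖a‖ * M))] with w hw hsymm x hx
  obtain ⟨⟨h1, h2, h3, h4, h5⟩, h6⟩ := hw
  have hax := abs_le.1 (abs_inner_le (a := a) hx)
  have hth := abs_scaledThreshold_le h1 hz h2 h3.le
    (v := form w.1 e₁ a) (by rw [residual, form_comm hsymm a e₁])
  have hth' := abs_le.1 (hth.trans h5)
  rw [scaledLower, scaledUpper, if_pos (by linarith), if_pos (by linarith)]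
  have h7 : |√(form w.1 e₁ e₁) - √(form V e₁ e₁)| * z =
      |(√(form w.1 e₁ e₁) - √(form V e₁ e₁)) * z| := by rw [abs_mul, abs_of_nonneg hz]
  rw [h7, abs_le] at h4
  constructor <;> rw [abs_le] <;> constructor <;> linarith

end Limits

end IICI

/-! ### Limiting coverage probabilities -/

namespace IICI

variable {k : ℕ}

lemma isStandardPair_multivariateGaussian {V : Matrix (Fin k) (Fin k) ℝ} (hV : V.PosSemidef)
    {u₁ u₂ : EuclideanSpace ℝ (Fin k)} (h₁ : form V u₁ u₁ = 1) (h₂ : form V u₂ u₂ = 1)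
    (h₁₂ : -1 < form V u₁ u₂) :
    IsStandardPair ((multivariateGaussian 0 V).map fun x => (inner ℝ u₁ x, inner ℝ u₂ x)) := by
  have hcov (x y : EuclideanSpace ℝ (Fin k)) :
      cov[fun u => inner ℝ x u, fun u => inner ℝ y u; multivariateGaussian 0 V] = form V x y := by
    rw [← covarianceBilin_apply_eq_cov IsGaussian.memLp_two_id,
      covarianceBilin_multivariateGaussian hV]
    rfl
  have hvar (x : EuclideanSpace ℝ (Fin k)) :
      Var[fun u => inner ℝ x u; multivariateGaussian 0 V] = form V x x := by
    rw [← hcov, covariance_self (by fun_prop)]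
  have hmean (x : EuclideanSpace ℝ (Fin k)) :
      ∫ u, inner ℝ x u ∂(multivariateGaussian 0 V) = 0 := by
    rw [integral_inner IsGaussian.integrable_fun_id]
    simp
  refine isStandardPair_of_hasGaussianLaw (by fun_prop) (by fun_prop) ?_ (hmean u₁) (hmean u₂)
    (by rw [hvar, h₁]) (by rw [hvar, h₂]) (by rwa [hcov])
  exact IsGaussian.hasGaussianLaw_id.map_fun ((innerSL ℝ u₁).prod (innerSL ℝ u₂))

lemma form_smul_sqrt_inv {V : Matrix (Fin k) (Fin k) ℝ} {x : EuclideanSpace ℝ (Fin k)}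
    (hx : 0 < form V x x) :
    form V ((√(form V x x))⁻¹ • x) ((√(form V x x))⁻¹ • x) = 1 := by
  rw [form_smul_left, form_smul_right]
  have := Real.sqrt_pos.2 hx
  have h := Real.mul_self_sqrt hx.le
  field_simp
  nlinarith

variable [NeZero k] {V : Matrix (Fin k) (Fin k) ℝ} {a : EuclideanSpace ℝ (Fin k)} {z h α : ℝ}

/-- The standardized first coordinates of the unrestricted and of the equality-imposed
estimator. -/
noncomputable def standardized (V : Matrix (Fin k) (Fin k) ℝ) (a x : EuclideanSpace ℝ (Fin k)) :
    ℝ × ℝ :=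
  (x 0 / √(form V e₁ e₁),
    (x 0 - (form V a a)⁻¹ * form V e₁ a * inner ℝ a x) / √(residual a V))

lemma continuous_standardized : Continuous (standardized V a) := by
  unfold standardized
  fun_prop

/-- With `y` the residual vector, `e₁'Vy = y'Vy > 0`: the equality-imposed component correlates
positively with the unrestricted one, which excludes correlation `-1`. -/
lemma isStandardPair_standardized (hV : V.PosDef)
    (ha : (a 0) • (e₁ : EuclideanSpace ℝ (Fin k)) ≠ a) :
    IsStandardPair ((multivariateGaussian 0 V).map (standardized V a)) := by
  have hσ := form_pos hV (e₁_ne_zero (k := k))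
  have hD := residual_pos hV ha
  have hw := form_pos hV (ne_zero_of_ne_smul_e₁ ha)
  set y := e₁ - ((form V a a)⁻¹ * form V e₁ a) • a with hy
  have hyy : form V y y = residual a V := form_residual_vector hV ha
  have hey : form V e₁ y = residual a V := by
    have hs : V.IsSymm := hV.isHermitian
    rw [hy, form_sub_right, form_smul_right, residual, form_comm hs a e₁]
    ring
  have h := isStandardPair_multivariateGaussian hV.posSemidef (form_smul_sqrt_inv hσ)
    (form_smul_sqrt_inv (x := y) (by rwa [hyy])) (by
      rw [form_smul_left, form_smul_right, hey]
      have : 0 ≤ (√(form V e₁ e₁))⁻¹ * ((√(form V y y))⁻¹ * residual a V) := by positivity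
      linarith)
  convert h using 2
  ext x
  · simp only [standardized, real_inner_smul_left, inner_e₁]
    ring
  · simp only [standardized, real_inner_smul_left, hyy]
    rw [hy, inner_sub_left, real_inner_smul_left, inner_e₁]
    ring

lemma measure_standardized_fst_eq (hV : V.PosDef)
    (ha : (a 0) • (e₁ : EuclideanSpace ℝ (Fin k)) ≠ a) (c : ℝ) :
    multivariateGaussian 0 V {x | (standardized V a x).1 = c} = 0 := by
  have := (isStandardPair_standardized hV ha).measure_fst_eq c
  rwa [Measure.map_apply continuous_standardized.measurable
    (measurableSet_eq_fun measurable_fst measurable_const)] at this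

lemma measure_standardized_snd_eq (hV : V.PosDef)
    (ha : (a 0) • (e₁ : EuclideanSpace ℝ (Fin k)) ≠ a) (c : ℝ) :
    multivariateGaussian 0 V {x | (standardized V a x).2 = c} = 0 := by
  have := (isStandardPair_standardized hV ha).measure_snd_eq c
  rwa [Measure.map_apply continuous_standardized.measurable
    (measurableSet_eq_fun measurable_snd measurable_const)] at this

/-- A minimum or maximum always equals one of its two arguments. -/
lemma measure_signedMin_eq_zero {E : Type*} [MeasurableSpace E] {ν : Measure E} {f g : E → ℝ}
    {v : ℝ} (hf : ν {x | f x = 0} = 0) (hg : ν {x | g x = 0} = 0) :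
    ν {x | signedMin v (f x) (g x) = 0} = 0 := by
  refine measure_mono_null (t := {x | f x = 0} ∪ {x | g x = 0}) (fun x hx => ?_)
    (measure_union_null hf hg)
  have hx' : signedMin v (f x) (g x) = 0 := hx
  unfold signedMin at hx'
  split_ifs at hx'
  · rcases min_choice (f x) (g x) with h | h <;> rw [h] at hx'
    exacts [Or.inl hx', Or.inr hx']
  · rcases max_choice (f x) (g x) with h | h <;> rw [h] at hx'
    exacts [Or.inl hx', Or.inr hx']

lemma measure_first_eq (hV : V.PosDef)
    (ha : (a 0) • (e₁ : EuclideanSpace ℝ (Fin k)) ≠ a) (c : ℝ) :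
    multivariateGaussian 0 V {x | x 0 = c} = 0 := by
  rw [← measure_standardized_fst_eq hV ha (c / √(form V e₁ e₁))]
  congr 1
  ext x
  have := Real.sqrt_pos.2 (form_pos hV (e₁_ne_zero (k := k)))
  simp [standardized, div_left_inj' this.ne']

lemma measure_second_eq (hV : V.PosDef)
    (ha : (a 0) • (e₁ : EuclideanSpace ℝ (Fin k)) ≠ a) (c : ℝ) :
    multivariateGaussian 0 V {x | x 0 - (form V a a)⁻¹ * form V e₁ a * inner ℝ a x = c} = 0 := by
  rw [← measure_standardized_snd_eq hV ha (c / √(residual a V))]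
  congr 1
  ext x
  have := Real.sqrt_pos.2 (residual_pos hV ha)
  simp [standardized, div_left_inj' this.ne']

lemma measure_limitLower_eq_zero (hV : V.PosDef)
    (ha : (a 0) • (e₁ : EuclideanSpace ℝ (Fin k)) ≠ a) :
    multivariateGaussian 0 V {x | limitLower V a z h x = 0} = 0 := by
  refine measure_signedMin_eq_zero ?_ ?_
  · rw [← measure_first_eq hV ha (√(form V e₁ e₁) * z)]
    congr 1; ext x; simp [sub_eq_zero]
  · rw [← measure_second_eq hV ha ((form V a a)⁻¹ * h * form V e₁ a + √(residual a V) * z)]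
    congr 1; ext x; simp only [Set.mem_ofPred_eq]
    constructor <;> intro <;> linarith

lemma measure_limitUpper_eq_zero (hV : V.PosDef)
    (ha : (a 0) • (e₁ : EuclideanSpace ℝ (Fin k)) ≠ a) :
    multivariateGaussian 0 V {x | limitUpper V a z h x = 0} = 0 := by
  refine measure_signedMin_eq_zero ?_ ?_
  · rw [← measure_first_eq hV ha (-(√(form V e₁ e₁) * z))]
    congr 1; ext x; simp [add_eq_zero_iff_eq_neg]
  · rw [← measure_second_eq hV ha ((form V a a)⁻¹ * h * form V e₁ a - √(residual a V) * z)]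
    congr 1; ext x; simp only [Set.mem_ofPred_eq]
    constructor <;> intro <;> linarith

/-- The limiting coverage probability in terms of an exchangeable pair of standard normal
variables. -/
lemma measureReal_limit_covers (hV : V.PosDef)
    (ha : (a 0) • (e₁ : EuclideanSpace ℝ (Fin k)) ≠ a) :
    (multivariateGaussian 0 V).real {x | limitLower V a z h x ≤ 0 ∧ 0 ≤ limitUpper V a z h x} =
      ((multivariateGaussian 0 V).map (standardized V a)).real
        (IsStandardPair.coverage z (-((form V a a)⁻¹ * h * |form V e₁ a|) / √(residual a V))) := by
  have hσ := Real.sqrt_pos.2 (form_pos hV (e₁_ne_zero (k := k)))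
  have hs := Real.sqrt_pos.2 (residual_pos hV ha)
  have hpair := isStandardPair_standardized hV ha
  have h1 (x : EuclideanSpace ℝ (Fin k)) : x 0 = √(form V e₁ e₁) * (standardized V a x).1 := by
    simp only [standardized]; field_simp
  have h2 (x : EuclideanSpace ℝ (Fin k)) :
      x 0 - (form V a a)⁻¹ * (inner ℝ a x + h) * form V e₁ a =
        √(residual a V) * ((standardized V a x).2 -
          (form V a a)⁻¹ * h * form V e₁ a / √(residual a V)) := by
    simp only [standardized]; field_simp; ring
  have hlow (x : EuclideanSpace ℝ (Fin k)) : limitLower V a z h x =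
      signedMin (form V e₁ a) (√(form V e₁ e₁) * ((standardized V a x).1 - z))
        (√(residual a V) * ((standardized V a x).2 -
          (form V a a)⁻¹ * h * form V e₁ a / √(residual a V) - z)) := by
    rw [limitLower, h2, h1]; congr 1 <;> ring
  have hup (x : EuclideanSpace ℝ (Fin k)) : limitUpper V a z h x =
      signedMin (form V e₁ a) (√(form V e₁ e₁) * ((standardized V a x).1 + z))
        (√(residual a V) * ((standardized V a x).2 -
          (form V a a)⁻¹ * h * form V e₁ a / √(residual a V) + z)) := by
    rw [limitUpper, h2, h1]; congr 1 <;> ring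
  have hn1 (r : ℝ) : √(form V e₁ e₁) * r ≤ 0 ↔ r ≤ 0 := by
    simpa using mul_le_mul_iff_right₀ (b := r) (c := 0) hσ
  have hn2 (r : ℝ) : √(residual a V) * r ≤ 0 ↔ r ≤ 0 := by
    simpa using mul_le_mul_iff_right₀ (b := r) (c := 0) hs
  have hp1 (r : ℝ) : 0 ≤ √(form V e₁ e₁) * r ↔ 0 ≤ r := mul_nonneg_iff_of_pos_left hσ
  have hp2 (r : ℝ) : 0 ≤ √(residual a V) * r ↔ 0 ≤ r := mul_nonneg_iff_of_pos_left hs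
  simp only [hlow, hup]
  rcases le_or_gt 0 (form V e₁ a) with hv | hv
  · rw [abs_of_nonneg hv, neg_div, measureReal_def, measureReal_def,
      Measure.map_apply continuous_standardized.measurable IsStandardPair.measurableSet_coverage]
    congr 2
    ext x
    simp only [signedMin, if_pos hv, min_le_iff, le_min_iff, hn1, hn2, hp1, hp2,
      IsStandardPair.coverage, Set.mem_ofPred_eq, Set.mem_preimage]
    grind
  -- For `v < 0` the endpoints are maxima; changing the sign of the pair exchanges their roles and
  -- turns them into minima with the same `d`.
  · have hmeas (d : ℝ) : MeasurableSet {p : ℝ × ℝ | (-p.1, -p.2) ∈ IsStandardPair.coverage z d} :=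
      IsStandardPair.measurableSet_coverage.preimage
        (f := fun p : ℝ × ℝ => (-p.1, -p.2)) (by fun_prop)
    rw [abs_of_neg hv, ← hpair.measureReal_neg IsStandardPair.measurableSet_coverage,
      measureReal_def, measureReal_def, Measure.map_apply continuous_standardized.measurable (hmeas _)]
    congr 2
    ext x
    have : -((form V a a)⁻¹ * h * -form V e₁ a) / √(residual a V) =
      (form V a a)⁻¹ * h * form V e₁ a / √(residual a V) := by ring
    simp only [signedMin, if_neg (not_le.2 hv), max_le_iff, le_max_iff, hn1, hn2, hp1, hp2,
      IsStandardPair.coverage, Set.mem_ofPred_eq, Set.mem_preimage, this]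
    grind

lemma le_measure_limit_covers (hV : V.PosDef)
    (ha : (a 0) • (e₁ : EuclideanSpace ℝ (Fin k)) ≠ a) (hz0 : 0 ≤ z)
    (hz : cdf (gaussianReal 0 1) z = 1 - α / 2) (hh : h ≤ 0) :
    ENNReal.ofReal (1 - α) ≤
      multivariateGaussian 0 V {x | limitLower V a z h x ≤ 0 ∧ 0 ≤ limitUpper V a z h x} := by
  rw [← ofReal_measureReal, measureReal_limit_covers hV ha]
  refine ENNReal.ofReal_le_ofReal
    ((isStandardPair_standardized hV ha).le_measureReal_coverage hz0 hz ?_)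
  have hw := form_pos hV (ne_zero_of_ne_smul_e₁ ha)
  rw [← mul_neg_one, mul_assoc, mul_assoc]
  have : 0 ≤ (form V a a)⁻¹ * (-h * |form V e₁ a|) :=
    mul_nonneg (by positivity) (mul_nonneg (by linarith) (abs_nonneg _))
  exact div_nonneg (by linarith) (Real.sqrt_nonneg _)

lemma measure_limit_covers_zero (hV : V.PosDef)
    (ha : (a 0) • (e₁ : EuclideanSpace ℝ (Fin k)) ≠ a) (hz0 : 0 ≤ z)
    (hz : cdf (gaussianReal 0 1) z = 1 - α / 2) :
    multivariateGaussian 0 V {x | limitLower V a z 0 x ≤ 0 ∧ 0 ≤ limitUpper V a z 0 x} =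
      ENNReal.ofReal (1 - α) := by
  rw [← ofReal_measureReal, measureReal_limit_covers hV ha]
  simp [(isStandardPair_standardized hV ha).measureReal_coverage_zero hz0 hz]

/-- Taking the degenerate pair `(X, X)` with `d = 0` turns the coverage event into `-z ≤ X ≤ z`. -/
lemma measure_unrestricted_covers (hV : V.PosDef) (hz0 : 0 ≤ z)
    (hz : cdf (gaussianReal 0 1) z = 1 - α / 2) :
    multivariateGaussian 0 V
      {x | x 0 - √(form V e₁ e₁) * z ≤ 0 ∧ 0 ≤ x 0 + √(form V e₁ e₁) * z} =
      ENNReal.ofReal (1 - α) := by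
  have hσ := form_pos hV (e₁_ne_zero (k := k))
  have hσ' := Real.sqrt_pos.2 hσ
  have h1 := form_smul_sqrt_inv hσ
  have hpair := isStandardPair_multivariateGaussian hV.posSemidef h1 h1 (by rw [h1]; norm_num)
  rw [← hpair.measureReal_coverage_zero hz0 hz, measureReal_def,
    Measure.map_apply (by fun_prop) IsStandardPair.measurableSet_coverage,
    ENNReal.ofReal_toReal (measure_ne_top _ _)]
  congr 1
  ext x
  have h2 : √(form V e₁ e₁) * ((√(form V e₁ e₁))⁻¹ * x 0) = x 0 := by field_simp
  simp only [IsStandardPair.coverage, Set.mem_ofPred_eq, Set.mem_preimage, real_inner_smul_left,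
    inner_e₁]
  set Z := (√(form V e₁ e₁))⁻¹ * x 0
  rw [← h2, ← mul_sub, ← mul_add, mul_nonneg_iff_of_pos_left hσ']
  have hn1 (r : ℝ) : √(form V e₁ e₁) * r ≤ 0 ↔ r ≤ 0 := by
    simpa using mul_le_mul_iff_right₀ (b := r) (c := 0) hσ'
  rw [hn1]
  grind

/-! ### Coverage along a subsequence -/

section Coverage

variable {Ω : ℕ → Type*} [∀ q, MeasurableSpace (Ω q)] {μ : ∀ q, Measure (Ω q)}
  [∀ q, IsProbabilityMeasure (μ q)] {N : ℕ → ℕ+} {θ : ℕ → EuclideanSpace ℝ (Fin k)}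
  {θhat : ∀ q, Ω q → EuclideanSpace ℝ (Fin k)} {Vhat : ∀ q, Ω q → Matrix (Fin k) (Fin k) ℝ}
  {b : ℝ}

theorem tendsto_measure_mem_interval (hV : V.PosDef)
    (ha : (a 0) • (e₁ : EuclideanSpace ℝ (Fin k)) ≠ a) (hα₀ : 0 < α) (hα₁ : α < 1)
    (hX : TendstoInDistribution (fun q ω => √((N q : ℕ+) : ℝ) • (θhat q ω - θ q)) atTop id μ
      (multivariateGaussian 0 V))
    (hW : TendstoInProb μ Vhat V) (hsymm : ∀ q, ∀ᵐ ω ∂(μ q), (Vhat q ω).IsSymm)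
    (ht : Tendsto (fun q => √((N q : ℕ+) : ℝ) * g a b (θ q)) atTop (𝓝 h)) :
    Tendsto (fun q => μ q {ω | θ q 0 ∈ interval (N q) α a b (θhat q ω) (Vhat q ω)}) atTop
      (𝓝 (multivariateGaussian 0 V {x | limitLower V a (normalQuantile (1 - α / 2)) h x ≤ 0 ∧
        0 ≤ limitUpper V a (normalQuantile (1 - α / 2)) h x})) := by
  have hz := normalQuantile_nonneg (p := 1 - α / 2) (by linarith) (by linarith)
  simp only [mem_interval_iff]
  refine tendsto_measure_nonpos_nonneg hX (continuous_limitLower h) (continuous_limitUpper h)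
    (measure_limitLower_eq_zero hV ha) (measure_limitUpper_eq_zero hV ha) fun ε hε => ?_
  exact tendsto_measure_not_of_eventually hX hW hsymm ht (p := fun x W t =>
      |scaledLower (form W e₁ a) (form W a a) √(form W e₁ e₁) √(residual a W)
          (normalQuantile (1 - α / 2)) (x 0) (inner ℝ a x + t) - limitLower V a (normalQuantile (1 - α / 2)) h x| ≤ ε ∧
      |scaledUpper (form W e₁ a) (form W a a) √(form W e₁ e₁) √(residual a W)
          (normalQuantile (1 - α / 2)) (x 0) (inner ℝ a x + t) - limitUpper V a (normalQuantile (1 - α / 2)) h x| ≤ ε)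
    (eventually_abs_sub_limit_le hV ha hz h hε)

theorem tendsto_measure_mem_interval_atBot (hV : V.PosDef)
    (ha : (a 0) • (e₁ : EuclideanSpace ℝ (Fin k)) ≠ a) (hα₀ : 0 < α) (hα₁ : α < 1)
    (hX : TendstoInDistribution (fun q ω => √((N q : ℕ+) : ℝ) • (θhat q ω - θ q)) atTop id μ
      (multivariateGaussian 0 V))
    (hW : TendstoInProb μ Vhat V) (hsymm : ∀ q, ∀ᵐ ω ∂(μ q), (Vhat q ω).IsSymm)
    (ht : Tendsto (fun q => √((N q : ℕ+) : ℝ) * g a b (θ q)) atTop atBot) :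
    Tendsto (fun q => μ q {ω | θ q 0 ∈ interval (N q) α a b (θhat q ω) (Vhat q ω)}) atTop
      (𝓝 (ENNReal.ofReal (1 - α))) := by
  have hz := normalQuantile_nonneg (p := 1 - α / 2) (by linarith) (by linarith)
  have hq := cdf_normalQuantile (p := 1 - α / 2) (by linarith) (by linarith)
  simp only [mem_interval_iff]
  rw [← measure_unrestricted_covers hV hz hq]
  refine tendsto_measure_nonpos_nonneg hX (by fun_prop) (by fun_prop) ?_ ?_ fun ε hε => ?_
  · rw [← measure_first_eq hV ha (√(form V e₁ e₁) * normalQuantile (1 - α / 2))]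
    simp [sub_eq_zero]
  · rw [← measure_first_eq hV ha (-(√(form V e₁ e₁) * normalQuantile (1 - α / 2)))]
    simp [add_eq_zero_iff_eq_neg]
  · exact tendsto_measure_not_of_eventually hX hW hsymm ht (p := fun x W t =>
      |scaledLower (form W e₁ a) (form W a a) √(form W e₁ e₁) √(residual a W)
          (normalQuantile (1 - α / 2)) (x 0) (inner ℝ a x + t) - (x 0 - √(form V e₁ e₁) * normalQuantile (1 - α / 2))| ≤ ε ∧
      |scaledUpper (form W e₁ a) (form W a a) √(form W e₁ e₁) √(residual a W)
          (normalQuantile (1 - α / 2)) (x 0) (inner ℝ a x + t) - (x 0 + √(form V e₁ e₁) * normalQuantile (1 - α / 2))| ≤ ε)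
      (eventually_abs_sub_limit_le_atBot hV ha hz hε)

end Coverage

end IICI

/-! ### From subsequences to uniform coverage. -/

/-- Either some `[B, 0]` is visited infinitely often, and compactness applies, or every level is
eventually undercut. -/
lemma exists_subseq_tendsto_nonpos_or_atBot {t : ℕ → ℝ} (ht : ∀ q, t q ≤ 0) :
    ∃ χ : ℕ → ℕ, StrictMono χ ∧
      ((∃ h ≤ 0, Tendsto (t ∘ χ) atTop (𝓝 h)) ∨ Tendsto (t ∘ χ) atTop atBot) := by
  by_cases hb : ∃ B : ℝ, ∃ᶠ q in atTop, B ≤ t q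
  · obtain ⟨B, hB⟩ := hb
    obtain ⟨h, hh, χ, hχ, hlim⟩ := isCompact_Icc.tendsto_subseq' (s := Set.Icc B 0)
      (hB.mono fun q hq => ⟨hq, ht q⟩)
    exact ⟨χ, hχ, Or.inl ⟨h, hh.2, hlim⟩⟩
  · push Not at hb
    exact ⟨id, strictMono_id, Or.inr (tendsto_atBot.2 fun B => (hb B).mono fun q hq => hq.le)⟩

theorem theorem2 {k : ℕ} [NeZero k]
    -- the parameter spaces, the sample spaces, the distributions and the true parameters
    {𝓕 : ℕ+ → Type*} [∀ n, Nonempty (𝓕 n)]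
    {Ω : ℕ+ → Type*} [∀ n, MeasurableSpace (Ω n)]
    (P : ∀ n, 𝓕 n → Measure (Ω n)) [∀ n F, IsProbabilityMeasure (P n F)]
    (θ : ∀ n, 𝓕 n → EuclideanSpace ℝ (Fin k))
    -- the estimators
    (θhat : ∀ n, Ω n → EuclideanSpace ℝ (Fin k)) (hθhat : ∀ n, Measurable (θhat n))
    (Vhat : ∀ n, Ω n → Matrix (Fin k) (Fin k) ℝ)
    (hVhat : ∀ n i j, Measurable (fun ω => Vhat n ω i j))
    (hsymm : ∀ n (F : 𝓕 n), ∀ᵐ ω ∂(P n F), (Vhat n ω).IsSymm)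
    -- the level and the linear inequality
    (α : ℝ) (hα₀ : 0 < α) (hα₁ : α < 1)
    (a : EuclideanSpace ℝ (Fin k)) (b : ℝ)
    (ha : (a 0) • (IICI.e₁ : EuclideanSpace ℝ (Fin k)) ≠ a)
    (hasy : IICI.AsymptoticNormality P θ θhat Vhat) :
    ENNReal.ofReal (1 - α) ≤
      liminf (fun n : ℕ+ => ⨅ (F : 𝓕 n) (_ : IICI.g a b (θ n F) ≤ 0),
        P n F {ω | θ n F 0 ∈ IICI.interval n α a b (θhat n ω) (Vhat n ω)}) atTop ∧
    ∀ F : (∀ n, 𝓕 n),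
      Tendsto (fun n : ℕ+ => √(n : ℝ) * IICI.g a b (θ n (F n))) atTop (𝓝 0) →
      Tendsto (fun n : ℕ+ =>
          P n (F n) {ω | θ n (F n) 0 ∈ IICI.interval n α a b (θhat n ω) (Vhat n ω)})
        atTop (𝓝 (ENNReal.ofReal (1 - α))) := by
  refine ⟨?_, fun F hF => ?_⟩
  · by_contra hlt
    obtain ⟨c, hc, hcα⟩ := exists_between (not_le.1 hlt)
    obtain ⟨ns, hns, hlt⟩ := exists_seq_forall_of_frequently
      (frequently_lt_of_liminf_lt (by isBoundedDefault) hc)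
    -- The asymptotic model takes a full sequence, so nearly worst-case distributions at the
    -- selected sample sizes are completed arbitrarily elsewhere.
    have hex : ∀ n : ℕ+, ∃ F : 𝓕 n, (∃ q, ns q = n) → IICI.g a b (θ n F) ≤ 0 ∧
        P n F {ω | θ n F 0 ∈ IICI.interval n α a b (θhat n ω) (Vhat n ω)} < c := by
      intro n
      by_cases hn : ∃ q, ns q = n
      · obtain ⟨q, rfl⟩ := hn
        obtain ⟨F, hF⟩ := iInf_lt_iff.1 (hlt q)
        obtain ⟨hg, hF⟩ := iInf_lt_iff.1 hF
        exact ⟨F, fun _ => ⟨hg, hF⟩⟩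
      · exact ⟨Classical.arbitrary _, fun h => absurd h hn⟩
    choose F hF using hex
    obtain ⟨χ₁, hχ₁, hφ₁⟩ := strictMono_subseq_of_tendsto_atTop hns
    -- The limit of `√n g(θ)` is fixed before the model supplies its further subsequence, along
    -- which it persists.
    obtain ⟨χ₂, hχ₂, hcases⟩ := exists_subseq_tendsto_nonpos_or_atBot
      (t := fun q => √((ns (χ₁ q) : ℕ+) : ℝ) * IICI.g a b (θ (ns (χ₁ q)) (F (ns (χ₁ q)))))
      fun q => mul_nonpos_of_nonneg_of_nonpos (Real.sqrt_nonneg _) (hF _ ⟨_, rfl⟩).1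
    obtain ⟨ψ, hψ, V, hV, hX, hW⟩ := hasy F (fun q => ns (χ₁ (χ₂ q))) (hφ₁.comp hχ₂)
    have hz := IICI.normalQuantile_nonneg (p := 1 - α / 2) (by linarith) (by linarith)
    have hq := IICI.cdf_normalQuantile (p := 1 - α / 2) (by linarith) (by linarith)
    have hbd (q : ℕ) := (hF (ns (χ₁ (χ₂ (ψ q)))) ⟨_, rfl⟩).2.le
    rcases hcases with ⟨h, hh, hlim⟩ | hlim
    · have hlim' := IICI.tendsto_measure_mem_interval hV ha hα₀ hα₁ hX hW (fun q => hsymm _ _)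
        (hlim.comp hψ.tendsto_atTop)
      exact absurd ((IICI.le_measure_limit_covers hV ha hz hq hh).trans
        (le_of_tendsto' hlim' hbd)) (not_le.2 hcα)
    · have hlim' := IICI.tendsto_measure_mem_interval_atBot hV ha hα₀ hα₁ hX hW
        (fun q => hsymm _ _) (hlim.comp hψ.tendsto_atTop)
      exact absurd (le_of_tendsto' hlim' hbd) (not_le.2 hcα)
  -- Here `h = 0` along every subsequence, so the limiting coverage is `1 - α` whichever `V` arises.
  · refine tendsto_of_subseq_tendsto fun ns hns => ?_
    obtain ⟨χ, hχ, hφ⟩ := strictMono_subseq_of_tendsto_atTop hns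
    obtain ⟨ψ, hψ, V, hV, hX, hW⟩ := hasy F (ns ∘ χ) hφ
    refine ⟨χ ∘ ψ, ?_⟩
    have hz := IICI.normalQuantile_nonneg (p := 1 - α / 2) (by linarith) (by linarith)
    have hq := IICI.cdf_normalQuantile (p := 1 - α / 2) (by linarith) (by linarith)
    rw [← IICI.measure_limit_covers_zero hV ha hz hq]
    exact IICI.tendsto_measure_mem_interval hV ha hα₀ hα₁ hX hW (fun q => hsymm _ _)
      (hF.comp (hns.comp (hχ.comp hψ).tendsto_atTop))
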